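/- For a graph $G$ and a set $A\subseteq V(G)$ let $S(G,A)$ denote Seidel's switch of $G$ by $A$, the graph on $V(G)$ with edge set $E(G)\mathbin{\triangle}\{xy : x\in A,\ y\in V(G)\setminus A\}$. A cut of $G$ is given by a set $V_1\subseteq V(G)$, and its cut-edges are the edges of $G$ with exactly one end-vertex in $V_1$. There is a polynomial-time algorithm that transforms every finite simple graph $G$ into a graph $G'$ with $|V(G')| = 4|V(G)|$ of the following form: each vertex $u$ of $G$ is replaced by four pairwise non-adjacent vertices $u',u'',u''',u''''$; each edge $uv$ of $G$ is replaced by a complete bipartite graph $K_{4,4}$ between the four-tuples of $u$ and $v$; and each pair $uv$ of distinct non-adjacent vertices of $G$ is replaced by the $8$ edges of a cycle that alternates between the four-tuples of $u$ and $v$ ($G'$ has no other edges). Moreover, if for some $n$ the graph $G$ has $2n$ vertices and minimum vertex degree $2n-4$, and the complement of $G$ contains no triangle, then for every integer $j$ the following statements are equivalent: (a) there is a cut in $G$ with at least $j$ cut-edges; (b) there is a set $A\subseteq V(G')$ such that $S(G',A)$ contains at most $|E(G')|-16j$ edges. -/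

import Mathlib

/-- A finite graph, given as the number `n` of its vertices together with a simple graph on the
vertex set `{0, …, n - 1}`. -/
abbrev FinGraph : Type := Σ n : ℕ, SimpleGraph (Fin n)

open Classical in
/-- The row of the vertex `u` in the adjacency matrix, as a word: one bit for every vertex, then
the end-of-row symbol `none`. -/
noncomputable def adjacencyRow {n : ℕ} (G : SimpleGraph (Fin n)) (u : Fin n) :
    List (Option Bool) :=
  (List.finRange n).map (fun v => some (decide (G.Adj u v))) ++ [none]

/-- The word that represents a graph as the input or output of a machine: its adjacency matrix,
row by row, over the alphabet `{0, 1, end-of-row}`. -/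
noncomputable def encodeGraph (G : FinGraph) : List (Option Bool) :=
  ((List.finRange G.1).map (adjacencyRow G.2)).flatten

/-- A graph can be recovered from the word that represents it. -/
theorem encodeGraph_injective : Function.Injective encodeGraph := by
  classical
  rintro ⟨n, G⟩ ⟨m, H⟩ h
  have hlen : ∀ (k : ℕ) (K : SimpleGraph (Fin k)),
      (encodeGraph ⟨k, K⟩).length = k * (k + 1) := by
    intro k K
    simp [encodeGraph, adjacencyRow, List.length_flatten, Function.comp_def]
  have hnm : n = m := by
    have h1 := congrArg List.length h
    rw [hlen, hlen] at h1
    rcases lt_trichotomy n m with h2 | h2 | h2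
    · nlinarith
    · exact h2
    · nlinarith
  subst hnm
  have h2 : (List.finRange n).map (adjacencyRow G) = (List.finRange n).map (adjacencyRow H) := by
    rw [List.eq_iff_flatten_eq]
    refine ⟨h, ?_⟩
    simp [adjacencyRow, Function.comp_def]
  have h3 : ∀ u v, G.Adj u v ↔ H.Adj u v := by
    intro u v
    have h4 := (List.map_inj_left.1 h2) u (List.mem_finRange u)
    have h5 := (List.map_inj_left.1 (List.append_cancel_right h4)) v (List.mem_finRange v)
    simpa using h5
  have : G = H := by
    ext u v
    exact h3 u v
  rw [this]

/-- The function `F` from graphs to graphs can be computed in polynomial time by a (multi-stack)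
Turing machine, when graphs are written down as adjacency matrices. -/
def PolyTimeGraphMap (F : FinGraph → FinGraph) : Prop :=
  Nonempty (Turing.TM2ComputableInPolyTime encodeGraph encodeGraph F)

/-- All the pairs `xy` with `x ∈ A` and `y ∉ A`. -/
def crossingPairs {V : Type*} (A : Set V) : Set (Sym2 V) :=
  {e | ∃ x ∈ A, ∃ y ∉ A, e = s(x, y)}

/-- Seidel's switch `S(G, A)`: the edge set is the symmetric difference of the edge set of `G`
and the set of all pairs `xy` with `x ∈ A`, `y ∉ A`. -/
def seidelSwitch {V : Type*} (G : SimpleGraph V) (A : Set V) : SimpleGraph V :=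
  SimpleGraph.fromEdgeSet (symmDiff G.edgeSet (crossingPairs A))

/-- The cut-edges of the cut `A`, `V \ A`: the edges with exactly one end-vertex in `A`. -/
def cutset {V : Type*} (G : SimpleGraph V) (A : Set V) : Set (Sym2 V) :=
  G.edgeSet ∩ crossingPairs A

open Classical in
/-- The graphs allowed in Large-Deg-Max-Cut: `2n` vertices for some `n`, minimum degree `2n - 4`,
and no triangle in the complement. -/
def IsLargeDegGraph {V : Type*} [Fintype V] (G : SimpleGraph V) : Prop :=
  ∃ n : ℕ, Fintype.card V = 2 * n ∧ (G.minDegree : ℤ) = 2 * (n : ℤ) - 4 ∧ Gᶜ.CliqueFree 3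

/-- `G'` arises from `G` by replacing every vertex `u` by an independent four-tuple
`e (u, 0), …, e (u, 3)`, every edge by a complete bipartite graph between the two four-tuples, and
every non-edge `uv` by the edges of an 8-cycle that alternates between the two four-tuples: for
suitable enumerations `p` and `q` of the two four-tuples, this is the cycle
`u_{p 0}, v_{q 1}, u_{p 1}, v_{q 2}, u_{p 2}, v_{q 3}, u_{p 3}, v_{q 0}`. -/
def IsFourTupleGraph {V W : Type*} (G : SimpleGraph V) (G' : SimpleGraph W) : Prop :=
  ∃ e : V × Fin 4 ≃ W,
    (∀ u i j, ¬ G'.Adj (e (u, i)) (e (u, j))) ∧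
    (∀ u v, G.Adj u v → ∀ i j, G'.Adj (e (u, i)) (e (v, j))) ∧
    (∀ u v, u ≠ v → ¬ G.Adj u v → ∃ p q : Equiv.Perm (Fin 4),
      ∀ i j, G'.Adj (e (u, p i)) (e (v, q j)) ↔ j = i ∨ j = i + 1)

/-! Encode a switching set by a ±1 vector on V(G') and let X(u) be the sum of the four signs over u.
Four times the number of edges lost by the switch is a sum over ordered pairs, split into blocks
(`sum_blowUp`): an edge uv of G gives 16 - X(u)X(v), a vertex u gives -(16 - X(u)²), and a non-edge
gives minus the bilinear form of the ±1 matrix of its 8-cycle. If every tuple is whole, X(u) = ±4,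
only the edges of G contribute and every cut-edge is worth 16. This is (a) → (b).

For the converse, broken tuples must do no better than whole ones (`exists_sign_adjForm_le`). The
adjacency form of G is affine in each coordinate, so X can be rounded to ±4 without increasing it
(`exists_rounding`). The free choice in G' is the partition of a tuple into antipodal pairs of each
8-cycle: the non-neighbours of u, at most three, receive distinct partitions of the tuple of u. If
X(u) = 0, the signs over u are constant on the pairs of one of the three partitions, and a cycle
with that partition contributes nothing (`exists_split`). Hence at most two non-edges at u help the
switch.

Discharging (`sum_nonNeighbors_le`) pays for this help out of the loss 16 - X(u)² and the decrease
of the form under rounding: two adjacent vertices with X = 0 are moved to opposite values and yield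
16 each (`exists_pairing`). The vertices with X = 0 left unpaired are independent in G, so there are
at most two of them; they are settled by one more move (`exists_mixed_move`) or by the absence of
triangles in the complement.

The partitions are chosen by ranks modulo 3, which a stack machine can maintain while it reads the
adjacency matrix once. -/

/-- An 8-cycle that alternates between two four-tuples, given by a symmetric relation. -/
def cyclePattern (i j : Fin 4) : Bool := decide (i + j = 0 ∨ i + j = 1)

/-- Three relabelings of a four-tuple that move the three partitions of it into two pairs to the
partition `{0, 2}, {1, 3}`. -/
def splitPerm (a : Fin 3) : Equiv.Perm (Fin 4) :=
  if a = 0 then 1 else if a = 1 then Equiv.swap 1 2 else Equiv.swap 2 3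

/-- The relation between two four-tuples: a complete one, an empty one, or an 8-cycle that is
twisted on both sides. -/
inductive BlockKind
  | edge
  | same
  | nonedge (a b : Fin 3)
  deriving DecidableEq, Fintype

/-- The adjacency relation between the members of two four-tuples. -/
def BlockKind.bit : BlockKind → Fin 4 → Fin 4 → Bool
  | .edge, _, _ => true
  | .same, _, _ => false
  | .nonedge a b, i, j => cyclePattern (splitPerm a i) (splitPerm b j)

/-- The number modulo `3` of the indices below `v` that are neither `u` nor related to `u`. -/
def nonadjRank (adj : ℕ → ℕ → Bool) (u : ℕ) : ℕ → Fin 3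
  | 0 => 0
  | v + 1 => if adj u v = false ∧ u ≠ v then nonadjRank adj u v + 1 else nonadjRank adj u v

/-- The kind of block that replaces the entry `u, v` of an adjacency matrix. -/
def blockKind (adj : ℕ → ℕ → Bool) (u v : ℕ) : BlockKind :=
  if adj u v then .edge else if u = v then .same
  else .nonedge (nonadjRank adj u v) (nonadjRank adj v u)

/-! ### The Turing machine and its elementary runs. -/

namespace BlowUpMachine

open Turing

/-- The contents of the machine. -/
inductive Stack
  | input
  | output
  | counters
  | newCounters
  | cells
  | cellsRev
  | outputRev
  deriving DecidableEq

instance : Fintype Stack where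
  elems := {.input, .output, .counters, .newCounters, .cells, .cellsRev, .outputRev}
  complete k := by cases k <;> decide

/-- The alphabets of the stacks. -/
abbrev Alphabet : Stack → Type
  | .input => Option Bool
  | .output => Option Bool
  | .counters => Fin 3 × Bool
  | .newCounters => Fin 3 × Bool
  | .cells => BlockKind
  | .cellsRev => BlockKind
  | .outputRev => Option Bool

/-- The program labels of the machine. -/
inductive Label
  | read
  | restore
  | flip (i : Fin 4)
  | emit (i : Fin 4)
  | clear
  | finish
  deriving DecidableEq, Fintype

/-- The registers of the machine: the rank of the current row, whether the diagonal has been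
passed, and one buffer for each kind of symbol. -/
structure Registers where
  rank : Fin 3
  passed : Bool
  sym : Option (Option Bool)
  counter : Option (Fin 3 × Bool)
  cell : Option BlockKind
  deriving DecidableEq, Fintype

/-- Registers with empty buffers. -/
def regs (r : Fin 3) (p : Bool) : Registers := ⟨r, p, none, none, none⟩

/-- The block that belongs to the matrix entry `b`, as seen by the machine. -/
def cellOf (b : Bool) (r : Fin 3) (p : Bool) (c : Fin 3 × Bool) : BlockKind :=
  if b then .edge else if !p && !c.2 then .same else .nonedge r c.1

/-- A rank counts a block if it comes from a non-edge. -/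
def bump (k : BlockKind) (r : Fin 3) : Fin 3 :=
  match k with
  | .nonedge _ _ => r + 1
  | _ => r

/-- The bit in the input buffer. -/
def Registers.bit (s : Registers) : Bool := (s.sym.getD none).getD false

/-- The counter in the buffer. -/
def Registers.cnt (s : Registers) : Fin 3 × Bool := s.counter.getD (0, false)

/-- The block computed from the buffers. -/
def Registers.block (s : Registers) : BlockKind := cellOf s.bit s.rank s.passed s.cnt

/-- The block in the buffer. -/
def Registers.blk (s : Registers) : BlockKind := s.cell.getD .same

/-- The program of the machine. -/
def program : Label → TM2.Stmt Alphabet Label Registers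
  | .read =>
    .pop .input (fun s (x : Option (Option Bool)) => { s with sym := x }) <|
    .branch (fun s => s.sym.isNone) (.goto fun _ => .clear) <|
    .branch (fun s => (s.sym.getD none).isNone)
      (.load (fun _ => regs 0 false) <| .goto fun _ => .restore) <|
    .pop .counters (fun s (x : Option (Fin 3 × Bool)) => { s with counter := x }) <|
    .push .newCounters (fun s => ((bump s.block s.cnt.1, s.cnt.2 || !s.passed) : Fin 3 × Bool)) <|
    .push .cells (fun s => s.block) <|
    .load (fun s => regs (bump s.block s.rank) (s.passed || !s.cnt.2)) <|
    .goto fun _ => .read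
  | .restore =>
    .pop .newCounters (fun s (x : Option (Fin 3 × Bool)) => { s with counter := x }) <|
    .branch (fun s => s.counter.isNone) (.goto fun _ => .flip 0) <|
    .push .counters (fun s => s.cnt) <|
    .load (fun _ => regs 0 false) <|
    .goto fun _ => .restore
  | .flip i =>
    .pop .cells (fun s (x : Option BlockKind) => { s with cell := x }) <|
    .branch (fun s => s.cell.isNone) (.goto fun _ => .emit i) <|
    .push .cellsRev (fun s => s.blk) <|
    .load (fun _ => regs 0 false) <|
    .goto fun _ => .flip i
  | .emit i =>
    .pop .cellsRev (fun s (x : Option BlockKind) => { s with cell := x }) <|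
    .branch (fun s => s.cell.isNone)
      (.push .outputRev (fun _ => (none : Option Bool)) <|
        .goto fun _ => if i = 3 then .read else .flip (i + 1)) <|
    .push .outputRev (fun s => some (s.blk.bit i 0)) <|
    .push .outputRev (fun s => some (s.blk.bit i 1)) <|
    .push .outputRev (fun s => some (s.blk.bit i 2)) <|
    .push .outputRev (fun s => some (s.blk.bit i 3)) <|
    .branch (fun _ => decide (i = 3))
      (.load (fun _ => regs 0 false) <| .goto fun _ => .emit i) <|
    .push .cells (fun s => s.blk) <|
    .load (fun _ => regs 0 false) <|
    .goto fun _ => .emit i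
  | .clear =>
    .pop .counters (fun s (x : Option (Fin 3 × Bool)) => { s with counter := x }) <|
    .branch (fun s => s.counter.isNone) (.goto fun _ => .finish) <|
    .load (fun _ => regs 0 false) <|
    .goto fun _ => .clear
  | .finish =>
    .pop .outputRev (fun s (x : Option (Option Bool)) => { s with sym := x }) <|
    .branch (fun s => s.sym.isNone) .halt <|
    .push .output (fun s => s.sym.getD none) <|
    .load (fun _ => regs 0 false) <|
    .goto fun _ => .finish

/-- The machine that replaces every entry of an adjacency matrix by a block. -/
def machine : FinTM2 where
  K := Stack
  k₀ := .input
  k₁ := .output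
  Γ := Alphabet
  Λ := Label
  main := .read
  σ := Registers
  initialState := regs 0 false
  Γk₀Fin := inferInstanceAs (Fintype (Option Bool))
  m := program

/-- The contents of all the stacks. -/
def contents (I O : List (Option Bool)) (C D : List (Fin 3 × Bool)) (T U : List BlockKind)
    (R : List (Option Bool)) : ∀ k, List (Alphabet k)
  | .input => I
  | .output => O
  | .counters => C
  | .newCounters => D
  | .cells => T
  | .cellsRev => U
  | .outputRev => R

section StackOperations

variable (I O : List (Option Bool)) (C D : List (Fin 3 × Bool)) (T U : List BlockKind)
  (R : List (Option Bool)) (s : Registers) (q : TM2.Stmt Alphabet Label Registers)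

/-- Every stack operation turns `contents` into `contents` again, so the program can be executed
symbolically by rewriting with this lemma and its analogues. -/
theorem stepAux_pop_input (f : Registers → Option (Alphabet .input) → Registers) :
    TM2.stepAux (.pop .input f q) s (contents I O C D T U R) =
      TM2.stepAux q (f s I.head?) (contents I.tail O C D T U R) := by
  simp only [TM2.stepAux]
  congr 1
  funext k; cases k <;> rfl

theorem stepAux_push_output (f : Registers → Alphabet .output) :
    TM2.stepAux (.push .output f q) s (contents I O C D T U R) =
      TM2.stepAux q s (contents I (f s :: O) C D T U R) := by
  simp only [TM2.stepAux]
  congr 1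
  funext k; cases k <;> rfl

theorem stepAux_pop_counters (f : Registers → Option (Alphabet .counters) → Registers) :
    TM2.stepAux (.pop .counters f q) s (contents I O C D T U R) =
      TM2.stepAux q (f s C.head?) (contents I O C.tail D T U R) := by
  simp only [TM2.stepAux]
  congr 1
  funext k; cases k <;> rfl

theorem stepAux_push_counters (f : Registers → Alphabet .counters) :
    TM2.stepAux (.push .counters f q) s (contents I O C D T U R) =
      TM2.stepAux q s (contents I O (f s :: C) D T U R) := by
  simp only [TM2.stepAux]
  congr 1
  funext k; cases k <;> rfl

theorem stepAux_pop_newCounters (f : Registers → Option (Alphabet .newCounters) → Registers) :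
    TM2.stepAux (.pop .newCounters f q) s (contents I O C D T U R) =
      TM2.stepAux q (f s D.head?) (contents I O C D.tail T U R) := by
  simp only [TM2.stepAux]
  congr 1
  funext k; cases k <;> rfl

theorem stepAux_push_newCounters (f : Registers → Alphabet .newCounters) :
    TM2.stepAux (.push .newCounters f q) s (contents I O C D T U R) =
      TM2.stepAux q s (contents I O C (f s :: D) T U R) := by
  simp only [TM2.stepAux]
  congr 1
  funext k; cases k <;> rfl

theorem stepAux_pop_cells (f : Registers → Option (Alphabet .cells) → Registers) :
    TM2.stepAux (.pop .cells f q) s (contents I O C D T U R) =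
      TM2.stepAux q (f s T.head?) (contents I O C D T.tail U R) := by
  simp only [TM2.stepAux]
  congr 1
  funext k; cases k <;> rfl

theorem stepAux_push_cells (f : Registers → Alphabet .cells) :
    TM2.stepAux (.push .cells f q) s (contents I O C D T U R) =
      TM2.stepAux q s (contents I O C D (f s :: T) U R) := by
  simp only [TM2.stepAux]
  congr 1
  funext k; cases k <;> rfl

theorem stepAux_pop_cellsRev (f : Registers → Option (Alphabet .cellsRev) → Registers) :
    TM2.stepAux (.pop .cellsRev f q) s (contents I O C D T U R) =
      TM2.stepAux q (f s U.head?) (contents I O C D T U.tail R) := by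
  simp only [TM2.stepAux]
  congr 1
  funext k; cases k <;> rfl

theorem stepAux_push_cellsRev (f : Registers → Alphabet .cellsRev) :
    TM2.stepAux (.push .cellsRev f q) s (contents I O C D T U R) =
      TM2.stepAux q s (contents I O C D T (f s :: U) R) := by
  simp only [TM2.stepAux]
  congr 1
  funext k; cases k <;> rfl

theorem stepAux_pop_outputRev (f : Registers → Option (Alphabet .outputRev) → Registers) :
    TM2.stepAux (.pop .outputRev f q) s (contents I O C D T U R) =
      TM2.stepAux q (f s R.head?) (contents I O C D T U R.tail) := by
  simp only [TM2.stepAux]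
  congr 1
  funext k; cases k <;> rfl

theorem stepAux_push_outputRev (f : Registers → Alphabet .outputRev) :
    TM2.stepAux (.push .outputRev f q) s (contents I O C D T U R) =
      TM2.stepAux q s (contents I O C D T U (f s :: R)) := by
  simp only [TM2.stepAux]
  congr 1
  funext k; cases k <;> rfl

end StackOperations

/-- A configuration of the machine. -/
def cfg (l : Option Label) (s : Registers) (I O : List (Option Bool)) (C D : List (Fin 3 × Bool))
    (T U : List BlockKind) (R : List (Option Bool)) : TM2.Cfg Alphabet Label Registers :=
  ⟨l, s, contents I O C D T U R⟩

/-- The machine gets from the configuration `c` to the configuration `d` in `n` steps. -/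
def Run (n : ℕ) (c d : TM2.Cfg Alphabet Label Registers) : Prop :=
  (_root_.flip bind (TM2.step program))^[n] (some c) = some d

theorem Run.refl (c : TM2.Cfg Alphabet Label Registers) : Run 0 c c := rfl

theorem Run.trans {m n : ℕ} {c d e : TM2.Cfg Alphabet Label Registers} (h : Run m c d)
    (h' : Run n d e) : Run (m + n) c e := by
  unfold Run at *
  rw [Nat.add_comm, Function.iterate_add_apply, h, h']

theorem Run.cast {m n : ℕ} {c d : TM2.Cfg Alphabet Label Registers} (h : Run m c d)
    (hmn : m = n) : Run n c d := hmn ▸ h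

theorem Run.single {c d : TM2.Cfg Alphabet Label Registers}
    (h : TM2.step program c = some d) : Run 1 c d := h

section Steps

variable (I O : List (Option Bool)) (C D : List (Fin 3 × Bool)) (T U : List BlockKind)
  (R : List (Option Bool))

theorem step_read_bit (b : Bool) (r : Fin 3) (p : Bool) :
    Run 1 (cfg (some .read) (regs r p) (some b :: I) O C D T U R)
      (cfg (some .read)
        (regs (bump (cellOf b r p (C.head?.getD (0, false))) r)
          (p || !(C.head?.getD (0, false)).2)) I O C.tail
        ((bump (cellOf b r p (C.head?.getD (0, false))) (C.head?.getD (0, false)).1,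
          (C.head?.getD (0, false)).2 || !p) :: D)
        (cellOf b r p (C.head?.getD (0, false)) :: T) U R) := by
  apply Run.single
  simp only [cfg, TM2.step.eq_2, program, TM2.stepAux.eq_4, TM2.stepAux.eq_5, TM2.stepAux.eq_6,
    stepAux_pop_input, stepAux_pop_counters, stepAux_push_newCounters, stepAux_push_cells]
  rfl

theorem step_read_end (r : Fin 3) (p : Bool) :
    Run 1 (cfg (some .read) (regs r p) (none :: I) O C D T U R)
      (cfg (some .restore) (regs 0 false) I O C D T U R) := by
  apply Run.single
  simp only [cfg, TM2.step.eq_2, program, TM2.stepAux.eq_4, TM2.stepAux.eq_5, TM2.stepAux.eq_6,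
    stepAux_pop_input]
  rfl

theorem step_read_nil :
    Run 1 (cfg (some .read) (regs 0 false) [] O C D T U R)
      (cfg (some .clear) (regs 0 false) [] O C D T U R) := by
  apply Run.single
  simp only [cfg, TM2.step.eq_2, program, TM2.stepAux.eq_4, TM2.stepAux.eq_5, TM2.stepAux.eq_6,
    stepAux_pop_input]
  rfl

theorem run_restore :
    Run (D.length + 1) (cfg (some .restore) (regs 0 false) I O C D T U R)
      (cfg (some (.flip 0)) (regs 0 false) I O (D.reverse ++ C) [] T U R) := by
  induction D generalizing C with
  | nil =>
    apply Run.single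
    simp only [cfg, TM2.step.eq_2, program, TM2.stepAux.eq_5, TM2.stepAux.eq_6,
      stepAux_pop_newCounters]
    rfl
  | cons d D ih =>
    have h : Run 1 (cfg (some .restore) (regs 0 false) I O C (d :: D) T U R)
        (cfg (some .restore) (regs 0 false) I O (d :: C) D T U R) := by
      apply Run.single
      simp only [cfg, TM2.step.eq_2, program, TM2.stepAux.eq_4, TM2.stepAux.eq_5,
        TM2.stepAux.eq_6, stepAux_pop_newCounters, stepAux_push_counters]
      rfl
    have h' := (h.trans (ih (d :: C))).cast (Nat.add_comm 1 _)
    simpa using h'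

theorem run_flip (i : Fin 4) :
    Run (T.length + 1) (cfg (some (.flip i)) (regs 0 false) I O C D T U R)
      (cfg (some (.emit i)) (regs 0 false) I O C D [] (T.reverse ++ U) R) := by
  induction T generalizing U with
  | nil =>
    apply Run.single
    simp only [cfg, TM2.step.eq_2, program, TM2.stepAux.eq_5, TM2.stepAux.eq_6, stepAux_pop_cells]
    rfl
  | cons t T ih =>
    have h : Run 1 (cfg (some (.flip i)) (regs 0 false) I O C D (t :: T) U R)
        (cfg (some (.flip i)) (regs 0 false) I O C D T (t :: U) R) := by
      apply Run.single
      simp only [cfg, TM2.step.eq_2, program, TM2.stepAux.eq_4, TM2.stepAux.eq_5,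
        TM2.stepAux.eq_6, stepAux_pop_cells, stepAux_push_cellsRev]
      rfl
    have h' := (h.trans (ih (t :: U))).cast (Nat.add_comm 1 _)
    simpa using h'

/-- The four bits that a block contributes to the row `i`. -/
def _root_.BlockKind.word (k : BlockKind) (i : Fin 4) : List (Option Bool) :=
  [some (k.bit i 0), some (k.bit i 1), some (k.bit i 2), some (k.bit i 3)]

/-- The row `i` of a line of blocks. -/
def rowWord (i : Fin 4) (U : List BlockKind) : List (Option Bool) :=
  U.flatMap (fun k => k.word i) ++ [none]

theorem run_emit (i : Fin 4) :
    Run (U.length + 1) (cfg (some (.emit i)) (regs 0 false) I O C D T U R)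
      (cfg (some (if i = 3 then .read else .flip (i + 1))) (regs 0 false) I O C D
        (if i = 3 then T else U.reverse ++ T) [] ((rowWord i U).reverse ++ R)) := by
  induction U generalizing T R with
  | nil =>
    apply Run.single
    simp only [cfg, TM2.step.eq_2, program, TM2.stepAux.eq_4, TM2.stepAux.eq_5, TM2.stepAux.eq_6,
      stepAux_pop_cellsRev, stepAux_push_outputRev]
    by_cases hi : i = 3
    · subst hi; rfl
    · simp only [hi, if_false]; rfl
  | cons t U ih =>
    have h : Run 1 (cfg (some (.emit i)) (regs 0 false) I O C D T (t :: U) R)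
        (cfg (some (.emit i)) (regs 0 false) I O C D (if i = 3 then T else t :: T) U
          ((t.word i).reverse ++ R)) := by
      apply Run.single
      simp only [cfg, TM2.step.eq_2, program, TM2.stepAux.eq_4, TM2.stepAux.eq_5,
        TM2.stepAux.eq_6, stepAux_pop_cellsRev, stepAux_push_outputRev, stepAux_push_cells]
      by_cases hi : i = 3
      · subst hi; rfl
      · simp only [hi, if_false, decide_false]; rfl
    have h' := (h.trans (ih _ _)).cast (Nat.add_comm 1 _)
    by_cases hi : i = 3
    · simpa [hi, rowWord] using h'
    · simpa [hi, rowWord] using h'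

theorem run_clear :
    Run (C.length + 1) (cfg (some .clear) (regs 0 false) I O C D T U R)
      (cfg (some .finish) (regs 0 false) I O [] D T U R) := by
  induction C with
  | nil =>
    apply Run.single
    simp only [cfg, TM2.step.eq_2, program, TM2.stepAux.eq_4, TM2.stepAux.eq_5, TM2.stepAux.eq_6,
      stepAux_pop_counters]
    rfl
  | cons c C ih =>
    have h : Run 1 (cfg (some .clear) (regs 0 false) I O (c :: C) D T U R)
        (cfg (some .clear) (regs 0 false) I O C D T U R) := by
      apply Run.single
      simp only [cfg, TM2.step.eq_2, program, TM2.stepAux.eq_4, TM2.stepAux.eq_5,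
        TM2.stepAux.eq_6, stepAux_pop_counters]
      rfl
    exact (h.trans ih).cast (Nat.add_comm 1 _)

theorem run_finish :
    Run (R.length + 1) (cfg (some .finish) (regs 0 false) I O C D T U R)
      (cfg none (regs 0 false) I (R.reverse ++ O) C D T U []) := by
  induction R generalizing O with
  | nil =>
    apply Run.single
    simp only [cfg, TM2.step.eq_2, program, TM2.stepAux.eq_5, stepAux_pop_outputRev]
    rfl
  | cons r R ih =>
    have h : Run 1 (cfg (some .finish) (regs 0 false) I O C D T U (r :: R))
        (cfg (some .finish) (regs 0 false) I (r :: O) C D T U R) := by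
      apply Run.single
      simp only [cfg, TM2.step.eq_2, program, TM2.stepAux.eq_4, TM2.stepAux.eq_5,
        TM2.stepAux.eq_6, stepAux_pop_outputRev, stepAux_push_output]
      rfl
    have h' := (h.trans (ih (r :: O))).cast (Nat.add_comm 1 _)
    simpa using h'

end Steps

end BlowUpMachine

/-! ### Correctness and running time of the machine on an adjacency matrix. -/

namespace BlowUpMachine

open Turing

section Rows

variable (adj : ℕ → ℕ → Bool)

/-- The counter of the column `v` before the row `u` is read. -/
def columnCounter (u v : ℕ) : Fin 3 × Bool := (nonadjRank adj v u, decide (v < u))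

/-- The counters of the columns before the row `u` is read. -/
def counterStack (n u : ℕ) : List (Fin 3 × Bool) :=
  if u = 0 then [] else (List.range n).map (columnCounter adj u)

/-- The machine has no access to indices. It recognises the diagonal by its two flags: `u < v` in
the register and `v < u` in the column counter are both false exactly when `u = v`. -/
theorem cellOf_eq_blockKind (irrefl : ∀ u, adj u u = false) (u v : ℕ) :
    cellOf (adj u v) (nonadjRank adj u v) (decide (u < v)) (columnCounter adj u v) =
      blockKind adj u v := by
  unfold cellOf blockKind columnCounter
  rcases lt_trichotomy u v with h | rfl | h
  · simp [h, h.ne]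
  · simp [irrefl]
  · simp [h, h.ne']

theorem bump_row (u v : ℕ) :
    bump (blockKind adj u v) (nonadjRank adj u v) = nonadjRank adj u (v + 1) := by
  rw [nonadjRank]
  unfold blockKind
  by_cases h : adj u v = true
  · simp [h, bump]
  · by_cases h' : u = v
    · subst h'; simp [h, bump]
    · simp [h, h', bump]

/-- By symmetry of the matrix, the entries above row `u` in column `v` are the first `u` entries of
row `v`; so a column counter yields the rank of `u` in row `v`. -/
theorem bump_column (symm : ∀ u v, adj u v = adj v u) (u v : ℕ) :
    bump (blockKind adj u v) (nonadjRank adj v u) = nonadjRank adj v (u + 1) := by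
  rw [nonadjRank]
  unfold blockKind
  rw [symm v u]
  by_cases h : adj u v = true
  · simp [h, bump]
  · by_cases h' : u = v
    · subst h'; simp [h, bump]
    · simp [h, h', Ne.symm h', bump]

variable (O : List (Option Bool)) (U : List BlockKind) (R : List (Option Bool))

theorem run_read (symm : ∀ u v, adj u v = adj v u) (irrefl : ∀ u, adj u u = false)
    (I : List (Option Bool)) (u k v : ℕ) (D : List (Fin 3 × Bool)) (T : List BlockKind) :
    Run k
      (cfg (some .read) (regs (nonadjRank adj u v) (decide (u < v)))
        ((List.range' v k).map (fun w => some (adj u w)) ++ I) O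
        (if u = 0 then [] else (List.range' v k).map (columnCounter adj u)) D T U R)
      (cfg (some .read) (regs (nonadjRank adj u (v + k)) (decide (u < v + k))) I O []
        (((List.range' v k).map (columnCounter adj (u + 1))).reverse ++ D)
        (((List.range' v k).map (blockKind adj u)).reverse ++ T) U R) := by
  induction k generalizing v D T with
  | zero => simpa using Run.refl _
  | succ k ih =>
    -- During row 0 the stack of counters is empty; the default `(0, false)` is then the correct
    -- counter, so no initialisation is needed.
    have hhead : (if u = 0 then [] else
        (List.range' v (k + 1)).map (columnCounter adj u)).head?.getD (0, false) =
          columnCounter adj u v := by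
      split_ifs with h
      · subst h; simp [columnCounter, nonadjRank]
      · simp [List.range'_succ]
    have htail : (if u = 0 then [] else
        (List.range' v (k + 1)).map (columnCounter adj u)).tail =
          if u = 0 then [] else (List.range' (v + 1) k).map (columnCounter adj u) := by
      split_ifs with h
      · rfl
      · simp [List.range'_succ]
    have h := step_read_bit ((List.range' (v + 1) k).map (fun w => some (adj u w)) ++ I) O
      (if u = 0 then [] else (List.range' v (k + 1)).map (columnCounter adj u)) D T U R
      (adj u v) (nonadjRank adj u v) (decide (u < v))
    rw [hhead, htail, cellOf_eq_blockKind adj irrefl, bump_row] at h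
    -- The column flag is false from `v = u` on, which makes `passed` become true exactly after the
    -- diagonal entry.
    have h1 : (decide (u < v) || !(columnCounter adj u v).2) = decide (u < v + 1) := by
      rw [Bool.eq_iff_iff]
      simp [columnCounter]
      omega
    have h2 : (bump (blockKind adj u v) (columnCounter adj u v).1,
        (columnCounter adj u v).2 || !decide (u < v)) = columnCounter adj (u + 1) v := by
      refine Prod.ext (bump_column adj symm u v) ?_
      rw [Bool.eq_iff_iff]
      simp [columnCounter]
      omega
    rw [h1, h2] at h
    have h' := (h.trans (ih (v + 1) _ _)).cast (Nat.add_comm 1 k)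
    simpa [List.range'_succ, Nat.add_assoc, Nat.add_comm 1 k] using h'

/-- The blocks of a row. -/
def rowBlocks (n u : ℕ) : List BlockKind := (List.range n).map (blockKind adj u)

/-- The four rows that replace a row. -/
def rowOutput (n u : ℕ) : List (Option Bool) :=
  (List.finRange 4).flatMap fun i => rowWord i (rowBlocks adj n u)

theorem run_row (symm : ∀ u v, adj u v = adj v u) (irrefl : ∀ u, adj u u = false)
    (I : List (Option Bool)) (n u : ℕ) :
    Run (10 * (n + 1))
      (cfg (some .read) (regs 0 false) ((List.range n).map (fun w => some (adj u w)) ++ none :: I)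
        O (counterStack adj n u) [] [] [] R)
      (cfg (some .read) (regs 0 false) I O (counterStack adj n (u + 1)) [] [] []
        ((rowOutput adj n u).reverse ++ R)) := by
  have h1 := run_read adj O [] R symm irrefl (none :: I) u n 0 [] []
  simp only [← List.range_eq_range', List.append_nil, Nat.zero_add] at h1
  have h2 := step_read_end I O [] ((List.range n).map (columnCounter adj (u + 1))).reverse
    (rowBlocks adj n u).reverse [] R (nonadjRank adj u n) (decide (u < n))
  have h3 := run_restore I O [] ((List.range n).map (columnCounter adj (u + 1))).reverse
    (rowBlocks adj n u).reverse [] R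
  have hC : ((List.range n).map (columnCounter adj (u + 1))).reverse.reverse ++ [] =
      counterStack adj n (u + 1) := by simp [counterStack]
  rw [hC] at h3
  have pass : ∀ (i : Fin 4) (R : List (Option Bool)), Run (2 * (n + 1))
      (cfg (some (.flip i)) (regs 0 false) I O (counterStack adj n (u + 1)) []
        (rowBlocks adj n u).reverse [] R)
      (cfg (some (if i = 3 then .read else .flip (i + 1))) (regs 0 false) I O
        (counterStack adj n (u + 1)) [] (if i = 3 then [] else (rowBlocks adj n u).reverse) []
        ((rowWord i (rowBlocks adj n u)).reverse ++ R)) := by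
    intro i R
    have h4 := run_flip I O (counterStack adj n (u + 1)) [] (rowBlocks adj n u).reverse [] R i
    have h5 := run_emit I O (counterStack adj n (u + 1)) [] [] (rowBlocks adj n u) R i
    simp only [List.reverse_reverse, List.append_nil] at h4 h5
    refine (h4.trans h5).cast ?_
    simp [rowBlocks]
    omega
  have p0 := pass 0 R
  have p1 := pass 1 ((rowWord 0 (rowBlocks adj n u)).reverse ++ R)
  have p2 := pass 2 ((rowWord 1 (rowBlocks adj n u)).reverse ++
    ((rowWord 0 (rowBlocks adj n u)).reverse ++ R))
  have p3 := pass 3 ((rowWord 2 (rowBlocks adj n u)).reverse ++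
    ((rowWord 1 (rowBlocks adj n u)).reverse ++ ((rowWord 0 (rowBlocks adj n u)).reverse ++ R)))
  have hout : (rowOutput adj n u).reverse ++ R = (rowWord 3 (rowBlocks adj n u)).reverse ++
      ((rowWord 2 (rowBlocks adj n u)).reverse ++ ((rowWord 1 (rowBlocks adj n u)).reverse ++
        ((rowWord 0 (rowBlocks adj n u)).reverse ++ R))) := by
    have : List.finRange 4 = [0, 1, 2, 3] := by decide
    simp [rowOutput, this]
  rw [hout]
  -- Reading takes `n + 1` steps, restoring the counters `n + 1`, and each of the four passes `2 *
  -- (n + 1)`.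
  refine ((((((h1.trans h2).trans h3).trans p0).trans p1).trans p2).trans p3).cast ?_
  simp
  omega

theorem run_rows (symm : ∀ u v, adj u v = adj v u) (irrefl : ∀ u, adj u u = false)
    (n k u : ℕ) :
    Run (k * (10 * (n + 1)))
      (cfg (some .read) (regs 0 false)
        ((List.range' u k).flatMap fun u => (List.range n).map (fun w => some (adj u w)) ++ [none])
        O (counterStack adj n u) [] [] [] R)
      (cfg (some .read) (regs 0 false) [] O (counterStack adj n (u + k)) [] [] []
        (((List.range' u k).flatMap (rowOutput adj n)).reverse ++ R)) := by
  induction k generalizing u R with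
  | zero => simpa using Run.refl _
  | succ k ih =>
    have h := run_row adj O R symm irrefl ((List.range' (u + 1) k).flatMap fun u =>
      (List.range n).map (fun w => some (adj u w)) ++ [none]) n u
    have h' := (h.trans (ih ((rowOutput adj n u).reverse ++ R) (u + 1))).cast
      (show _ = (k + 1) * (10 * (n + 1)) by ring)
    simpa [List.range'_succ, Nat.add_assoc, Nat.add_comm 1 k] using h'

/-- The word that the machine writes. -/
def output (n : ℕ) : List (Option Bool) := (List.range n).flatMap (rowOutput adj n)

theorem length_output (n : ℕ) : (output adj n).length = n * (4 * (4 * n + 1)) := by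
  have h1 : ∀ (U : List BlockKind) (i : Fin 4), (rowWord i U).length = 4 * U.length + 1 := by
    intro U i
    simp [rowWord, List.length_flatMap, BlockKind.word]
    ring
  simp [output, List.length_flatMap, rowOutput, h1, rowBlocks]
  left
  ring

theorem run_all (symm : ∀ u v, adj u v = adj v u) (irrefl : ∀ u, adj u u = false) (n : ℕ) :
    ∃ t ≤ 30 * (n * (n + 1)) + 10, Run t
      (cfg (some .read) (regs 0 false)
        ((List.range n).flatMap fun u => (List.range n).map (fun w => some (adj u w)) ++ [none])
        [] [] [] [] [] [])
      (cfg none (regs 0 false) [] (output adj n) [] [] [] [] []) := by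
  have h1 := run_rows adj [] [] symm irrefl n n 0
  have h2 := step_read_nil [] (counterStack adj n n) [] [] [] (output adj n).reverse
  have h3 := run_clear [] [] (counterStack adj n n) [] [] [] (output adj n).reverse
  have h4 := run_finish [] [] [] [] [] [] (output adj n).reverse
  simp only [← List.range_eq_range', List.append_nil, Nat.zero_add, List.reverse_reverse]
    at h1 h4
  refine ⟨_, ?_, ((h1.trans h2).trans h3).trans h4⟩
  have : (counterStack adj n n).length ≤ n := by
    unfold counterStack
    split_ifs <;> simp
  simp only [List.length_reverse, length_output]
  nlinarith

end Rows

/-! ### Passing from machine runs to polynomial-time computability. -/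

section Encoding

open Classical in
/-- The adjacency matrix of a graph, extended by `false`. -/
noncomputable def natAdj (G : FinGraph) (u v : ℕ) : Bool :=
  if h : u < G.1 ∧ v < G.1 then decide (G.2.Adj ⟨u, h.1⟩ ⟨v, h.2⟩) else false

theorem natAdj_val (G : FinGraph) (u v : Fin G.1) : natAdj G u v = true ↔ G.2.Adj u v := by
  simp [natAdj]

theorem natAdj_symm (G : FinGraph) (u v : ℕ) : natAdj G u v = natAdj G v u := by
  unfold natAdj
  by_cases h : u < G.1 ∧ v < G.1
  · simp [h, G.2.adj_comm ⟨u, h.1⟩]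
  · have h' : ¬ (v < G.1 ∧ u < G.1) := fun h' => h ⟨h'.2, h'.1⟩
    simp [h, h']

theorem natAdj_self (G : FinGraph) (u : ℕ) : natAdj G u u = false := by
  simp [natAdj]

theorem length_encodeGraph (G : FinGraph) : (encodeGraph G).length = G.1 * (G.1 + 1) := by
  simp [encodeGraph, adjacencyRow, List.length_flatten, Function.comp_def]

theorem encodeGraph_eq (G : FinGraph) :
    encodeGraph G = (List.range G.1).flatMap fun u =>
      (List.range G.1).map (fun w => some (natAdj G u w)) ++ [none] := by
  have hr : List.range G.1 = (List.finRange G.1).map Fin.val := by simp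
  rw [hr, encodeGraph, List.flatMap_map, List.flatMap]
  congr 1
  refine List.map_congr_left fun u _ => ?_
  simp only [adjacencyRow, List.map_map]
  congr 1
  refine List.map_congr_left fun v _ => ?_
  simp [natAdj]

/-- A function from graphs to graphs that replaces the entries of the adjacency matrix by blocks
can be computed in polynomial time. -/
theorem polyTimeGraphMap_of_output {F : FinGraph → FinGraph}
    (hF : ∀ G : FinGraph, encodeGraph (F G) = output (natAdj G) G.1) : PolyTimeGraphMap F := by
  -- The input has length `n * (n + 1)`, so a bound quadratic in `n` is linear in the input length.
  refine ⟨{ tm := machine, inputAlphabet := Equiv.refl _, outputAlphabet := Equiv.refl _,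
            time := 30 * Polynomial.X + 10, outputsFun := fun G => ?_ }⟩
  have h := run_all (natAdj G) (natAdj_symm G) (natAdj_self G) G.1
  rw [← encodeGraph_eq, ← hF] at h
  refine ⟨⟨h.choose, ?_⟩, ?_⟩
  · have h' := h.choose_spec.2
    have hin : initList machine (List.map (Equiv.refl _).invFun (encodeGraph G)) =
        cfg (some .read) (regs 0 false) (encodeGraph G) [] [] [] [] [] [] := by
      unfold initList cfg
      congr 1
      funext k
      cases k <;> first | rfl | exact List.map_id _
    have hout : haltList machine (List.map (Equiv.refl _).invFun (encodeGraph (F G))) =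
        cfg none (regs 0 false) [] (encodeGraph (F G)) [] [] [] [] [] := by
      unfold haltList cfg
      congr 1
      funext k
      cases k <;> first | rfl | exact List.map_id _
    rw [Option.map_some]
    exact (congrArg _ (congrArg some hin)).trans (Eq.trans h' (congrArg some hout).symm)
  · refine h.choose_spec.1.trans ?_
    simp [length_encodeGraph]

end Encoding

end BlowUpMachine

/-! ### The bilinear forms of twisted 8-cycles. -/

/-- The sign matrix of a twisted 8-cycle: `1` for an edge and `-1` for a non-edge. -/
def blockSign (a b : Fin 3) (i j : Fin 4) : ℤ :=
  if (BlockKind.nonedge a b).bit i j then 1 else -1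

/-- The bilinear form of the sign matrix of a twisted 8-cycle. -/
def blockForm (a b : Fin 3) (x y : Fin 4 → ℤ) : ℤ :=
  ∑ i, ∑ j, blockSign a b i j * (x i * y j)

theorem blockSign_symm (a b : Fin 3) (i j : Fin 4) : blockSign a b i j = blockSign b a j i := by
  revert a b i j; decide

/-- Each vertex of the cycle has two neighbours and two non-neighbours in the other tuple. This
removes the constant term of a non-edge block. -/
theorem sum_blockSign (a b : Fin 3) : ∑ i, ∑ j, blockSign a b i j = 0 := by
  revert a b; decide

theorem blockForm_symm (a b : Fin 3) (x y : Fin 4 → ℤ) :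
    blockForm a b x y = blockForm b a y x := by
  unfold blockForm
  rw [Finset.sum_comm]
  refine Finset.sum_congr rfl fun i _ => Finset.sum_congr rfl fun j _ => ?_
  rw [blockSign_symm a b, mul_comm (x j)]

theorem splitPerm_symm_apply (a : Fin 3) (i : Fin 4) : (splitPerm a).symm i = splitPerm a i := by
  revert a i; decide

theorem blockSign_splitPerm (a b : Fin 3) (i j : Fin 4) :
    blockSign a b (splitPerm a i) (splitPerm b j) = blockSign 0 0 i j := by
  revert a b i j; decide

theorem blockForm_eq_base (a b : Fin 3) (x y : Fin 4 → ℤ) :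
    blockForm a b x y =
      blockForm 0 0 (fun i => x ((splitPerm a).symm i)) (fun i => y ((splitPerm b).symm i)) := by
  unfold blockForm
  rw [← Equiv.sum_comp (splitPerm a)]
  refine Finset.sum_congr rfl fun i _ => ?_
  rw [← Equiv.sum_comp (splitPerm b)]
  refine Finset.sum_congr rfl fun j _ => ?_
  simp only [blockSign_splitPerm, splitPerm_symm_apply]

/-- Antipodal vertices of the cycle have complementary neighbourhoods, so rows 0, 2 and rows 1, 3 of
the sign matrix are opposite and only the differences of `x` on antipodal pairs enter. -/
theorem blockForm_base (x y : Fin 4 → ℤ) :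
    blockForm 0 0 x y = (x 0 - x 2) * (y 0 + y 1 - y 2 - y 3) +
      (x 1 - x 3) * (y 0 - y 1 - y 2 + y 3) := by
  have h : ∀ i j, blockSign 0 0 i j =
      (![![1, 1, -1, -1], ![1, -1, -1, 1], ![-1, -1, 1, 1], ![-1, 1, 1, -1]] :
        Fin 4 → Fin 4 → ℤ) i j := by
    decide
  simp only [blockForm, h, Fin.sum_univ_four]
  simp
  ring

/-- With `a = y 0 - y 2` and `b = y 1 - y 3` the form is at least `-2|a + b| - 2|a - b| = -4
max(|a|, |b|) ≥ -8`. If both sums are ±2, just one difference of `x` is nonzero and it meets a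
factor ±2, which gives ±4; a constant tuple gives 0. -/
theorem blockForm_base_bounds {x y : Fin 4 → ℤ} (hx : ∀ i, x i = 1 ∨ x i = -1)
    (hy : ∀ i, y i = 1 ∨ y i = -1) :
    (∑ i, x i = 4 ∨ ∑ i, x i = -4 → blockForm 0 0 x y = 0) ∧
    (-8 ≤ blockForm 0 0 x y) ∧
    (∑ i, x i ≠ 0 → ∑ i, y i ≠ 0 → -4 ≤ blockForm 0 0 x y) := by
  rw [blockForm_base]
  simp only [Fin.sum_univ_four]
  rcases hx 0 with h0 | h0 <;> rcases hx 1 with h1 | h1 <;> rcases hx 2 with h2 | h2 <;>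
    rcases hx 3 with h3 | h3 <;> rcases hy 0 with k0 | k0 <;> rcases hy 1 with k1 | k1 <;>
    rcases hy 2 with k2 | k2 <;> rcases hy 3 with k3 | k3 <;>
    simp only [h0, h1, h2, h3, k0, k1, k2, k3] <;> decide

/-- Two positive and two negative signs form one of the three partitions into pairs. If the cycle
has these as its antipodal pairs, both differences of `x` vanish, whatever the other tuple is. -/
theorem exists_split {x : Fin 4 → ℤ} (hx : ∀ i, x i = 1 ∨ x i = -1) (h : ∑ i, x i = 0) :
    ∃ k, ∀ b y, blockForm k b x y = 0 := by
  suffices ∃ k, x ((splitPerm k).symm 0) = x ((splitPerm k).symm 2) ∧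
      x ((splitPerm k).symm 1) = x ((splitPerm k).symm 3) by
    obtain ⟨k, h1, h2⟩ := this
    refine ⟨k, fun b y => ?_⟩
    rw [blockForm_eq_base, blockForm_base]
    simp [h1, h2]
  have e00 : splitPerm 0 0 = 0 := by decide
  have e01 : splitPerm 0 1 = 1 := by decide
  have e02 : splitPerm 0 2 = 2 := by decide
  have e03 : splitPerm 0 3 = 3 := by decide
  have e10 : splitPerm 1 0 = 0 := by decide
  have e11 : splitPerm 1 1 = 2 := by decide
  have e12 : splitPerm 1 2 = 1 := by decide
  have e13 : splitPerm 1 3 = 3 := by decide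
  have e20 : splitPerm 2 0 = 0 := by decide
  have e21 : splitPerm 2 1 = 1 := by decide
  have e22 : splitPerm 2 2 = 3 := by decide
  have e23 : splitPerm 2 3 = 2 := by decide
  simp only [splitPerm_symm_apply]
  rw [Fin.sum_univ_four] at h
  by_cases h1 : x 0 = x 1
  · refine ⟨1, ?_⟩
    rw [e10, e11, e12, e13]
    rcases hx 0 with h0 | h0 <;> rcases hx 2 with h2 | h2 <;> rcases hx 3 with h3 | h3 <;> omega
  · by_cases h2 : x 0 = x 2
    · refine ⟨0, ?_⟩
      rw [e00, e01, e02, e03]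
      rcases hx 0 with h0 | h0 <;> rcases hx 1 with h2 | h2 <;> rcases hx 3 with h3 | h3 <;> omega
    · refine ⟨2, ?_⟩
      rw [e20, e21, e22, e23]
      rcases hx 0 with h0 | h0 <;> rcases hx 1 with h2 | h2 <;> rcases hx 3 with h3 | h3 <;> omega

theorem blockForm_eq_zero {x y : Fin 4 → ℤ} (a b : Fin 3) (hx : ∀ i, x i = 1 ∨ x i = -1)
    (hy : ∀ i, y i = 1 ∨ y i = -1) (h : ∑ i, x i = 4 ∨ ∑ i, x i = -4) : blockForm a b x y = 0 := by
  rw [blockForm_eq_base]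
  refine (blockForm_base_bounds (fun i => hx _) (fun i => hy _)).1 ?_
  rwa [Equiv.sum_comp]

theorem neg_eight_le_blockForm {x y : Fin 4 → ℤ} (a b : Fin 3) (hx : ∀ i, x i = 1 ∨ x i = -1)
    (hy : ∀ i, y i = 1 ∨ y i = -1) : -8 ≤ blockForm a b x y := by
  rw [blockForm_eq_base]
  exact (blockForm_base_bounds (fun i => hx _) (fun i => hy _)).2.1

theorem neg_four_le_blockForm {x y : Fin 4 → ℤ} (a b : Fin 3) (hx : ∀ i, x i = 1 ∨ x i = -1)
    (hy : ∀ i, y i = 1 ∨ y i = -1) (h : ∑ i, x i ≠ 0) (h' : ∑ i, y i ≠ 0) :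
    -4 ≤ blockForm a b x y := by
  rw [blockForm_eq_base]
  refine (blockForm_base_bounds (fun i => hx _) (fun i => hy _)).2.2 ?_ ?_
  · rwa [Equiv.sum_comp]
  · rwa [Equiv.sum_comp]

theorem sum_sign_cases {x : Fin 4 → ℤ} (hx : ∀ i, x i = 1 ∨ x i = -1) :
    (∑ i, x i = 4 ∨ ∑ i, x i = -4) ∨ (∑ i, x i = 2 ∨ ∑ i, x i = -2) ∨ ∑ i, x i = 0 := by
  rw [Fin.sum_univ_four]
  rcases hx 0 with h0 | h0 <;> rcases hx 1 with h1 | h1 <;> rcases hx 2 with h2 | h2 <;>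
    rcases hx 3 with h3 | h3 <;> omega

theorem single_sub_single_apply_left {V : Type*} [DecidableEq V] {u v : V} (h : u ≠ v) :
    (Pi.single u 1 + (-1 : ℤ) • Pi.single v 1 : V → ℤ) u = 1 := by
  simp [h]

theorem single_sub_single_apply_right {V : Type*} [DecidableEq V] {u v : V} (h : u ≠ v) :
    (Pi.single u 1 + (-1 : ℤ) • Pi.single v 1 : V → ℤ) v = -1 := by
  simp [h.symm]

theorem single_sub_single_apply_of_ne {V : Type*} [DecidableEq V] {u v w : V} (h : w ≠ u) (h' : w
  ≠ v) :
    (Pi.single u 1 + (-1 : ℤ) • Pi.single v 1 : V → ℤ) w = 0 := by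
  simp [h, h']

/-! ### Lowering the adjacency form by moving coordinates to ±4. -/

section Rounding

variable {V : Type*} [Fintype V] (G : SimpleGraph V) [DecidableRel G.Adj]

/-- The bilinear form of the adjacency matrix. -/
def adjForm (X Y : V → ℤ) : ℤ := ∑ u, ∑ v, if G.Adj u v then X u * Y v else 0

theorem adjForm_symm (X Y : V → ℤ) : adjForm G X Y = adjForm G Y X := by
  unfold adjForm
  rw [Finset.sum_comm]
  refine Finset.sum_congr rfl fun u _ => Finset.sum_congr rfl fun v _ => ?_
  simp only [G.adj_comm v u, mul_comm]

theorem adjForm_add_left (X X' Y : V → ℤ) :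
    adjForm G (X + X') Y = adjForm G X Y + adjForm G X' Y := by
  simp only [adjForm, ← Finset.sum_add_distrib]
  refine Finset.sum_congr rfl fun u _ => Finset.sum_congr rfl fun v _ => ?_
  split_ifs <;> simp [add_mul]

theorem adjForm_smul_left (c : ℤ) (X Y : V → ℤ) :
    adjForm G (c • X) Y = c * adjForm G X Y := by
  simp only [adjForm, Finset.mul_sum]
  refine Finset.sum_congr rfl fun u _ => Finset.sum_congr rfl fun v _ => ?_
  split_ifs <;> simp [mul_assoc]

theorem adjForm_add_smul_self (c : ℤ) (X d : V → ℤ) :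
    adjForm G (X + c • d) (X + c • d) =
      adjForm G X X + 2 * c * adjForm G X d + c ^ 2 * adjForm G d d := by
  rw [adjForm_add_left, adjForm_smul_left, adjForm_symm G X, adjForm_symm G d, adjForm_add_left,
    adjForm_add_left, adjForm_smul_left, adjForm_smul_left, adjForm_symm G d X]
  ring

/-- Along a direction of negative curvature, one of two opposite moves lowers the form. -/
theorem adjForm_move (X d : V → ℤ) {κ p q : ℤ} (hd : adjForm G d d = -κ) (hp : 0 < p)
    (hq : 0 < q) :
    adjForm G (X + p • d) (X + p • d) ≤ adjForm G X X - κ * (p * q) ∨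
      adjForm G (X + (-q) • d) (X + (-q) • d) ≤ adjForm G X X - κ * (p * q) := by
  rw [adjForm_add_smul_self, adjForm_add_smul_self, hd]
  -- The average of the two new values with weights `q` and `p` is exactly the claimed bound; the
  -- case split decides which of them lies below it.
  rcases le_total (2 * adjForm G X d) (κ * (p - q)) with h | h
  · left; nlinarith
  · right; nlinarith

variable [DecidableEq V]

theorem adjForm_single (u v : V) :
    adjForm G (Pi.single u 1) (Pi.single v 1) = if G.Adj u v then 1 else 0 := by
  unfold adjForm
  rw [Finset.sum_eq_single u, Finset.sum_eq_single v]
  · simp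
  · intro w _ hw; simp [hw]
  · simp
  · intro w _ hw; simp [hw]
  · simp

theorem adjForm_single_self (u : V) : adjForm G (Pi.single u 1) (Pi.single u 1) = 0 := by
  simp [adjForm_single]

theorem adjForm_single_sub_single {u v : V} (h : G.Adj u v) :
    adjForm G (Pi.single u 1 + (-1 : ℤ) • Pi.single v 1)
      (Pi.single u 1 + (-1 : ℤ) • Pi.single v 1) = -2 := by
  rw [adjForm_add_smul_self]
  simp [adjForm_single, h]

/-- The adjacency matrix has zero diagonal, so the form is affine in each coordinate and one of the
two ends of `[-4, 4]` does not increase it. The induction is on the number of coordinates not yet at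
an end. -/
theorem exists_rounding (X : V → ℤ) (hX : ∀ u, |X u| ≤ 4) :
    ∃ s : V → ℤ, (∀ u, s u = 1 ∨ s u = -1) ∧
      adjForm G ((4 : ℤ) • s) ((4 : ℤ) • s) ≤ adjForm G X X := by
  induction hk : (Finset.univ.filter fun u => ¬ (X u = 4 ∨ X u = -4)).card using
    Nat.strong_induction_on generalizing X with
  | _ k ih =>
  by_cases hall : ∀ u, X u = 4 ∨ X u = -4
  · refine ⟨fun u => X u / 4, fun u => ?_, le_of_eq ?_⟩
    · rcases hall u with h | h <;> simp [h]
    · have : ((4 : ℤ) • fun u => X u / 4) = X := by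
        funext u
        rcases hall u with h | h <;> simp [h]
      rw [this]
  · push Not at hall
    obtain ⟨u, hu1, hu2⟩ := hall
    have hb := abs_le.1 (hX u)
    have step : ∀ c : ℤ, X u + c = 4 ∨ X u + c = -4 →
        adjForm G (X + c • Pi.single u 1) (X + c • Pi.single u 1) ≤ adjForm G X X →
        ∃ s : V → ℤ, (∀ u, s u = 1 ∨ s u = -1) ∧
          adjForm G ((4 : ℤ) • s) ((4 : ℤ) • s) ≤ adjForm G X X := by
      intro c hc hle
      have hu : (X + c • (Pi.single u 1 : V → ℤ)) u = X u + c := by simp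
      have hne : ∀ v, v ≠ u → (X + c • (Pi.single u 1 : V → ℤ)) v = X v := by
        intro v hv; simp [hv]
      have hcard : (Finset.univ.filter fun w => ¬ ((X + c • (Pi.single u 1 : V → ℤ)) w = 4 ∨
          (X + c • (Pi.single u 1 : V → ℤ)) w = -4)).card < k := by
        rw [← hk]
        refine Finset.card_lt_card ⟨fun v hv => ?_, fun hsub => ?_⟩
        · simp only [Finset.mem_filter, Finset.mem_univ, true_and] at hv ⊢
          by_cases hvu : v = u
          · subst hvu; rw [hu] at hv; exact absurd hc hv
          · rwa [hne v hvu] at hv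
        · have := hsub (Finset.mem_filter.2 ⟨Finset.mem_univ u, by simp [hu1, hu2]⟩)
          simp only [Finset.mem_filter, Finset.mem_univ, true_and, hu] at this
          exact this hc
      have hbound : ∀ v, |(X + c • (Pi.single u 1 : V → ℤ)) v| ≤ 4 := by
        intro v
        by_cases hvu : v = u
        · subst hvu; rw [hu]; rcases hc with h | h <;> simp [h]
        · rw [hne v hvu]; exact hX v
      obtain ⟨s, hs, hs'⟩ := ih _ hcard _ hbound rfl
      exact ⟨s, hs, hs'.trans hle⟩
    have hp : 0 < 4 - X u := by omega
    have hq : 0 < X u + 4 := by omega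
    rcases adjForm_move G X (Pi.single u 1) (κ := 0) (by simp [adjForm_single_self]) hp hq with h
      | h
    · exact step (4 - X u) (by left; ring) (by linarith)
    · exact step (-(X u + 4)) (by right; ring) (by linarith)

/-- Pairing up adjacent vertices of `E` greedily and giving opposite values to the members of a
pair. -/
theorem exists_pairing (E : Finset V) :
    ∃ L ⊆ E, (∀ u ∈ L, ∀ v ∈ L, ¬ G.Adj u v) ∧
      ∀ X : V → ℤ, (∀ u ∈ E \ L, X u = 0) → ∃ X' : V → ℤ, (∀ u ∉ E \ L, X' u = X u) ∧
        (∀ u ∈ E \ L, X' u = 4 ∨ X' u = -4) ∧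
        adjForm G X' X' ≤ adjForm G X X - 16 * (E \ L).card := by
  induction E using Finset.strongInduction with
  | H E ih =>
  by_cases hE : ∀ u ∈ E, ∀ v ∈ E, ¬ G.Adj u v
  · exact ⟨E, subset_rfl, hE, fun X _ => ⟨X, by simp⟩⟩
  push Not at hE
  obtain ⟨u, hu, v, hv, huv⟩ := hE
  have hne : u ≠ v := huv.ne
  have hssub : (E.erase u).erase v ⊂ E :=
    (Finset.erase_subset _ _).trans_ssubset (Finset.erase_ssubset hu)
  obtain ⟨L, hLE, hL, hX⟩ := ih _ hssub
  have huL : u ∉ L := fun h => by simpa using hLE h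
  have hvL : v ∉ L := fun h => by simpa using hLE h
  have hdiff : E \ L = insert u (insert v ((E.erase u).erase v \ L)) := by
    ext w
    simp only [Finset.mem_sdiff, Finset.mem_insert, Finset.mem_erase]
    by_cases h1 : w = u
    · subst h1; simp [hu, huL]
    · by_cases h2 : w = v
      · subst h2; simp [hv, hvL]
      · simp [h1, h2]
  have huD : u ∉ (E.erase u).erase v \ L := by simp
  have hvD : v ∉ (E.erase u).erase v \ L := by simp
  have hcard : ((E \ L).card : ℤ) = ((E.erase u).erase v \ L).card + 2 := by
    rw [hdiff, Finset.card_insert_of_notMem (by simp [hne]), Finset.card_insert_of_notMem hvD]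
    push_cast
    ring
  refine ⟨L, hLE.trans hssub.subset, hL, fun X hX0 => ?_⟩
  rw [hcard]
  rw [hdiff] at hX0 ⊢
  obtain ⟨X', h1, h2, h3⟩ := hX X fun w hw => hX0 w (by simp [hw])
  have hu0 : X' u = 0 := (h1 u huD).trans (hX0 u (by simp))
  have hv0 : X' v = 0 := (h1 v hvD).trans (hX0 v (by simp))
  have step : ∀ c : ℤ, c = 4 ∨ c = -4 →
      adjForm G (X' + c • (Pi.single u 1 + (-1 : ℤ) • Pi.single v 1))
        (X' + c • (Pi.single u 1 + (-1 : ℤ) • Pi.single v 1)) ≤ adjForm G X' X' - 2 * (4 * 4) →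
      ∃ X' : V → ℤ, (∀ w ∉ insert u (insert v ((E.erase u).erase v \ L)), X' w = X w) ∧
        (∀ w ∈ insert u (insert v ((E.erase u).erase v \ L)), X' w = 4 ∨ X' w = -4) ∧
        adjForm G X' X' ≤ adjForm G X X - 16 * ((((E.erase u).erase v \ L).card : ℤ) + 2) := by
    intro c hc hle
    refine ⟨_, fun w hw => ?_, fun w hw => ?_, hle.trans (by linarith)⟩
    · simp only [Finset.mem_insert, not_or] at hw
      rw [Pi.add_apply, Pi.smul_apply, single_sub_single_apply_of_ne hw.1 hw.2.1, smul_zero,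
        add_zero, h1 w hw.2.2]
    · by_cases hwu : w = u
      · subst hwu
        rw [Pi.add_apply, Pi.smul_apply, single_sub_single_apply_left hne, hu0]
        rcases hc with h | h <;> simp [h]
      · by_cases hwv : w = v
        · subst hwv
          rw [Pi.add_apply, Pi.smul_apply, single_sub_single_apply_right hne, hv0]
          rcases hc with h | h <;> simp [h]
        · rw [Pi.add_apply, Pi.smul_apply, single_sub_single_apply_of_ne hwu hwv, smul_zero,
            add_zero]
          simp only [Finset.mem_insert, hwu, hwv, false_or] at hw
          exact h2 w hw
  -- The direction has curvature -2, so a move by ±4 from `(0, 0)` saves `2 * (4 * 4) = 32`, that is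
  -- 16 for each of the two vertices.
  rcases adjForm_move G X' _ (p := 4) (q := 4) (κ := 2) (adjForm_single_sub_single G huv)
    (by norm_num) (by norm_num) with h | h
  · exact step _ (by simp) h
  · exact step _ (by simp) h

/-- Opposite moves at two adjacent vertices with the values `0` and `2` or `-2`. -/
theorem exists_mixed_move (X : V → ℤ) (hX : ∀ w, |X w| ≤ 4) {u o : V} (huo : G.Adj u o)
    (hu : X u = 0) (ho : X o = 2 ∨ X o = -2) :
    ∃ X' : V → ℤ, (∀ w, |X' w| ≤ 4) ∧ adjForm G X' X' ≤ adjForm G X X - 16 := by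
  have hne : u ≠ o := huo.ne
  have step : ∀ c : ℤ, |c| ≤ 4 → |X o - c| ≤ 4 →
      adjForm G (X + c • (Pi.single u 1 + (-1 : ℤ) • Pi.single o 1))
        (X + c • (Pi.single u 1 + (-1 : ℤ) • Pi.single o 1)) ≤ adjForm G X X - 16 →
      ∃ X' : V → ℤ, (∀ w, |X' w| ≤ 4) ∧ adjForm G X' X' ≤ adjForm G X X - 16 := by
    intro c hc hc' hle
    refine ⟨_, fun w => ?_, hle⟩
    rw [Pi.add_apply, Pi.smul_apply]
    by_cases hwu : w = u
    · subst hwu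
      rw [single_sub_single_apply_left hne, hu]
      simpa using hc
    · by_cases hwo : w = o
      · subst hwo
        rw [single_sub_single_apply_right hne]
        simpa [sub_eq_add_neg] using hc'
      · rw [single_sub_single_apply_of_ne hwu hwo]
        simpa using hX w
  -- The value at `o` leaves room 4 on one side and only 2 on the other, so the saving is `2 * (4 *
  -- 2) = 16`.
  rcases ho with ho | ho
  · rcases adjForm_move G X _ (p := 4) (q := 2) (κ := 2) (adjForm_single_sub_single G huo)
      (by norm_num) (by norm_num) with h | h
    · exact step 4 (by norm_num) (by rw [ho]; norm_num) (by linarith)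
    · exact step (-2) (by norm_num) (by rw [ho]; norm_num) (by linarith)
  · rcases adjForm_move G X _ (p := 2) (q := 4) (κ := 2) (adjForm_single_sub_single G huo)
      (by norm_num) (by norm_num) with h | h
    · exact step 2 (by norm_num) (by rw [ho]; norm_num) (by linarith)
    · exact step (-4) (by norm_num) (by rw [ho]; norm_num) (by linarith)

end Rounding

/-! ### Discharging the non-edges onto the broken tuples. -/

section Discharging

variable {V : Type*}

/-- For a tuple with sum 0, the rank `k` of its neutral partition costs nothing; at most two members
of `N` have one of the other two ranks. -/
theorem sum_le_two_mul_of_injOn {N : Finset V} {ρ : V → Fin 3} (hρ : Set.InjOn ρ N) (k : Fin 3)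
    {f : V → ℤ} {c : ℤ} (hc : 0 ≤ c) (h0 : ∀ v ∈ N, ρ v = k → f v ≤ 0) (h1 : ∀ v ∈ N, f v ≤ c) :
    ∑ v ∈ N, f v ≤ 2 * c := by
  have hcard : (N.filter fun v => ρ v ≠ k).card ≤ 2 := by
    have : (N.filter fun v => ρ v ≠ k).card ≤ (Finset.univ.erase k).card := by
      refine Finset.card_le_card_of_injOn ρ (fun v hv => ?_) (hρ.mono fun v hv => ?_)
      · simp only [Finset.coe_filter, Set.mem_ofPred_eq] at hv
        simpa using hv.2
      · simp only [Finset.coe_filter, Set.mem_ofPred_eq] at hv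
        exact hv.1
    simpa using this
  calc ∑ v ∈ N, f v ≤ ∑ v ∈ N, if ρ v ≠ k then c else 0 := by
        refine Finset.sum_le_sum fun v hv => ?_
        split_ifs with h
        · exact h1 v hv
        · exact h0 v hv (not_not.1 h)
    _ = (N.filter fun v => ρ v ≠ k).card * c := by
        rw [← Finset.sum_filter, Finset.sum_const, nsmul_eq_mul]
    _ ≤ 2 * c := by
        have : ((N.filter fun v => ρ v ≠ k).card : ℤ) ≤ 2 := by exact_mod_cast hcard
        exact mul_le_mul_of_nonneg_right this hc

theorem card_le_three_of_injOn {N : Finset V} {ρ : V → Fin 3} (hρ : Set.InjOn ρ N) :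
    N.card ≤ 3 := by
  simpa using Finset.card_le_card_of_injOn (t := Finset.univ) ρ (fun v _ => Finset.mem_univ _) hρ

variable [Fintype V] [DecidableEq V] (G : SimpleGraph V) [DecidableRel G.Adj]

/-- The vertices other than `u` that are not adjacent to `u`. -/
def nonNeighbors (u : V) : Finset V := Finset.univ.filter fun v => v ≠ u ∧ ¬ G.Adj u v

theorem mem_nonNeighbors {u v : V} : v ∈ nonNeighbors G u ↔ v ≠ u ∧ ¬ G.Adj u v := by
  simp [nonNeighbors]

theorem mem_nonNeighbors_comm {u v : V} : v ∈ nonNeighbors G u ↔ u ∈ nonNeighbors G v := by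
  rw [mem_nonNeighbors, mem_nonNeighbors, G.adj_comm, ne_comm]

/-- The charge that the vertex `u` sends to the non-edge `uv`, where `O`, `E` and `L ⊆ E` are the
sets of vertices of odd type, of even type, and of unpaired vertices of even type. -/
def charge (O E L : Finset V) (r : V → V → Fin 3) (k : V → Fin 3) (q : ℤ) (u v : V) : ℤ :=
  if u ∈ O then (if v ∈ O then 4 else if v ∈ L then 4 * q else 0)
  else if u ∈ E then
    (if r u v = k u then 0
    else if u ∈ L then (if v ∈ O then 16 - 4 * q else if v ∈ L then 8 else 0)
    else 16)
  else 0

/-- The discharging argument: the total weight of the non-edges is at most the total budget of the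
vertices, if the charge of every vertex is within its budget. -/
theorem sum_nonNeighbors_le (r : V → V → Fin 3) (x : V → Fin 4 → ℤ)
    (hx : ∀ u i, x u i = 1 ∨ x u i = -1) (O E L : Finset V)
    (hO : ∀ u, u ∈ O ↔ ∑ i, x u i = 2 ∨ ∑ i, x u i = -2) (hE : ∀ u, u ∈ E ↔ ∑ i, x u i = 0)
    (k : V → Fin 3)
    (hk : ∀ u ∈ E, ∀ b y, blockForm (k u) b (x u) y = 0) (q : ℤ) (hq : 0 ≤ q) (hq' : q ≤ 4)
    (budget : V → ℤ)
    (hbudget : ∀ u, ∑ v ∈ nonNeighbors G u, charge O E L r k q u v ≤ budget u) :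
    -∑ u, ∑ v ∈ nonNeighbors G u, blockForm (r u v) (r v u) (x u) (x v) ≤ ∑ u, budget u := by
  have hOE : ∀ u, u ∈ O → u ∉ E := by
    intro u h h'
    rw [hO] at h
    rw [hE] at h'
    omega
  have hcharge : ∀ u v, 0 ≤ charge O E L r k q u v := by
    intro u v
    unfold charge
    split_ifs <;> linarith
  -- The form is at least -8, so charges totalling 16 always suffice; for two odd tuples the bound
  -- -4 makes 8 enough. Non-edges at whole tuples and at neutral partitions are free.
  have hpair : ∀ u v, -2 * blockForm (r u v) (r v u) (x u) (x v) ≤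
      charge O E L r k q u v + charge O E L r k q v u := by
    intro u v
    have hsymm := blockForm_symm (r u v) (r v u) (x u) (x v)
    have hzero : blockForm (r u v) (r v u) (x u) (x v) = 0 →
        -2 * blockForm (r u v) (r v u) (x u) (x v) ≤
          charge O E L r k q u v + charge O E L r k q v u := by
      intro h
      rw [h]
      linarith [hcharge u v, hcharge v u]
    have h8 := neg_eight_le_blockForm (r u v) (r v u) (hx u) (hx v)
    rcases sum_sign_cases (hx u) with hu | hu | hu
    · exact hzero (blockForm_eq_zero _ _ (hx u) (hx v) hu)
    · have huO := (hO u).2 hu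
      rcases sum_sign_cases (hx v) with hv | hv | hv
      · exact hzero (hsymm.trans (blockForm_eq_zero _ _ (hx v) (hx u) hv))
      · have hvO := (hO v).2 hv
        have h4 := neg_four_le_blockForm (r u v) (r v u) (hx u) (hx v) (by omega) (by omega)
        simp only [charge, huO, hvO, if_true]
        linarith
      · have hvE := (hE v).2 hv
        have hvO : v ∉ O := fun h => hOE v h hvE
        by_cases hin : r v u = k v
        · exact hzero (hsymm.trans (by rw [hin]; exact hk v hvE _ _))
        · by_cases hvL : v ∈ L
          · simp only [charge, huO, hvO, hvL, hvE, hin, if_true, if_false]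
            linarith
          · simp only [charge, huO, hvO, hvL, hvE, hin, if_true, if_false]
            linarith
    · have huE := (hE u).2 hu
      have huO : u ∉ O := fun h => hOE u h huE
      by_cases hin : r u v = k u
      · exact hzero (by rw [hin]; exact hk u huE _ _)
      rcases sum_sign_cases (hx v) with hv | hv | hv
      · exact hzero (hsymm.trans (blockForm_eq_zero _ _ (hx v) (hx u) hv))
      · have hvO := (hO v).2 hv
        by_cases huL : u ∈ L
        · simp only [charge, huO, hvO, huL, huE, hin, if_true, if_false]
          linarith
        · simp only [charge, huO, hvO, huL, huE, hin, if_true, if_false]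
          linarith
      · have hvE := (hE v).2 hv
        have hvO : v ∉ O := fun h => hOE v h hvE
        by_cases hin' : r v u = k v
        · exact hzero (hsymm.trans (by rw [hin']; exact hk v hvE _ _))
        · by_cases huL : u ∈ L <;> by_cases hvL : v ∈ L <;>
            simp only [charge, huO, hvO, huL, hvL, huE, hvE, hin, hin', if_true, if_false] <;>
            linarith
  have hswap : ∑ u, ∑ v ∈ nonNeighbors G u, charge O E L r k q v u =
      ∑ u, ∑ v ∈ nonNeighbors G u, charge O E L r k q u v := by
    refine Finset.sum_comm' fun u v => ?_
    simp [mem_nonNeighbors_comm G (u := u)]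
  have hsum : ∑ u, ∑ v ∈ nonNeighbors G u, -2 * blockForm (r u v) (r v u) (x u) (x v) ≤
      ∑ u, ∑ v ∈ nonNeighbors G u, (charge O E L r k q u v + charge O E L r k q v u) :=
    Finset.sum_le_sum fun u _ => Finset.sum_le_sum fun v _ => hpair u v
  simp only [Finset.sum_add_distrib, hswap, ← Finset.mul_sum] at hsum
  have := Finset.sum_le_sum fun u (_ : u ∈ Finset.univ) => hbudget u
  linarith

/-- Whole tuples do as well as broken ones. -/
theorem exists_sign_adjForm_le (r : V → V → Fin 3) (x : V → Fin 4 → ℤ)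
    (hx : ∀ u i, x u i = 1 ∨ x u i = -1)
    (hr : ∀ u, Set.InjOn (r u) (nonNeighbors G u))
    (htri : ∀ u v w, v ∈ nonNeighbors G u → w ∈ nonNeighbors G u → v ∉ nonNeighbors G w) :
    ∃ s : V → ℤ, (∀ u, s u = 1 ∨ s u = -1) ∧
      adjForm G ((4 : ℤ) • s) ((4 : ℤ) • s) ≤
        adjForm G (fun u => ∑ i, x u i) (fun u => ∑ i, x u i) +
          ∑ u, (16 - (∑ i, x u i) ^ 2) +
          ∑ u, ∑ v ∈ nonNeighbors G u, blockForm (r u v) (r v u) (x u) (x v) := by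
  set X : V → ℤ := fun u => ∑ i, x u i with hXdef
  set O : Finset V := Finset.univ.filter fun u => X u = 2 ∨ X u = -2 with hOdef
  set E : Finset V := Finset.univ.filter fun u => X u = 0 with hEdef
  have hO : ∀ u, u ∈ O ↔ X u = 2 ∨ X u = -2 := by simp [hOdef]
  have hE : ∀ u, u ∈ E ↔ X u = 0 := by simp [hEdef]
  have hOE : ∀ u, u ∈ O → u ∉ E := by
    intro u h h'
    rw [hO] at h
    rw [hE] at h'
    omega
  have hcases : ∀ u, (X u = 4 ∨ X u = -4) ∨ (X u = 2 ∨ X u = -2) ∨ X u = 0 :=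
    fun u => sum_sign_cases (hx u)
  have hk : ∀ u, ∃ k, u ∈ E → ∀ b y, blockForm k b (x u) y = 0 := by
    intro u
    by_cases h : u ∈ E
    · obtain ⟨k, hk⟩ := exists_split (hx u) ((hE u).1 h)
      exact ⟨k, fun _ => hk⟩
    · exact ⟨0, fun h' => absurd h' h⟩
  choose k hk using hk
  obtain ⟨L, hLE, hL, hpair⟩ := exists_pairing G E
  obtain ⟨X₁, hX₁, hX₁', hle₁⟩ := hpair X fun u hu => (hE u).1 (Finset.mem_sdiff.1 hu).1
  have hLO : ∀ u, u ∈ L → u ∉ O := fun u hu h => hOE u h (hLE hu)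
  have hnon : ∀ u ∈ L, ∀ v ∈ L, u ≠ v → v ∈ nonNeighbors G u := fun u hu v hv h =>
    (mem_nonNeighbors G).2 ⟨h.symm, hL u hu v hv⟩
  -- Three unpaired vertices would be a triangle of the complement.
  have hLcard : L.card ≤ 2 := by
    by_contra! h
    obtain ⟨a, b, c, ha, hb, hc, hab, hac, hbc⟩ := Finset.two_lt_card_iff.1 h
    exact htri a b c (hnon a ha b hb hab) (hnon a ha c hc hac) (hnon c hc b hb hbc.symm)
  have hb₁ : ∀ w, |X₁ w| ≤ 4 := by
    intro w
    by_cases hw : w ∈ E \ L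
    · rcases hX₁' w hw with h | h <;> simp [h]
    · rw [hX₁ w hw]
      rcases hcases w with (h | h) | (h | h) | h <;> simp [h]
  -- The 32 available to a paired vertex is `16 - X u ^ 2 = 16` together with the 16 saved by its
  -- pair.
  have hpaired : ∀ (q : ℤ) (u : V), u ∈ E → u ∉ L →
      ∑ v ∈ nonNeighbors G u, charge O E L r k q u v ≤ 32 := by
    intro q u hu huL
    have huO : u ∉ O := fun h => hOE u h hu
    refine sum_le_two_mul_of_injOn (hr u) (k u) (c := 16) (by norm_num) (fun v _ h => ?_)
      fun v _ => ?_
    · simp [charge, huO, hu, h]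
    · simp only [charge, huO, hu, huL, if_true, if_false]
      split_ifs <;> norm_num
  have hwhole : ∀ (q : ℤ) (u : V), u ∉ O → u ∉ E →
      ∑ v ∈ nonNeighbors G u, charge O E L r k q u v = 0 := by
    intro q u huO huE
    refine Finset.sum_eq_zero fun v _ => ?_
    simp [charge, huO, huE]
  -- An odd tuple pays `4 * q` of the 16 due on a non-edge to `L`; `e` is the overdraft allowed to
  -- each member of `L`. An odd tuple itself has `16 - 4 = 12` to spend.
  have main : ∀ (q e : ℤ), 0 ≤ q → q ≤ 4 →
      (∀ u ∈ O, ∑ v ∈ nonNeighbors G u, charge O E L r k q u v ≤ 12) →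
      (∀ u ∈ L, ∑ v ∈ nonNeighbors G u, charge O E L r k q u v ≤ 16 + e) →
      -∑ u, ∑ v ∈ nonNeighbors G u, blockForm (r u v) (r v u) (x u) (x v) ≤
        ∑ u, (16 - X u ^ 2) + 16 * (E \ L).card + e * L.card := by
    intro q e hq hq' h1 h2
    have h := sum_nonNeighbors_le G r x hx O E L hO hE k (fun u hu => hk u hu) q hq hq'
      (fun u => (16 - X u ^ 2) + (if u ∈ E \ L then 16 else 0) + (if u ∈ L then e else 0))
      (fun u => ?_)
    · refine h.trans (le_of_eq ?_)
      rw [Finset.sum_add_distrib, Finset.sum_add_distrib, Finset.sum_ite_mem,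
        Finset.sum_ite_mem, Finset.sum_const, Finset.sum_const]
      simp
      ring
    · by_cases huO : u ∈ O
      · have huE := hOE u huO
        have huL : u ∉ L := fun h => huE (hLE h)
        have : X u ^ 2 = 4 := by rcases (hO u).1 huO with h | h <;> rw [h] <;> norm_num
        simp only [Finset.mem_sdiff, huE, huL, this, false_and, if_false]
        linarith [h1 u huO]
      · by_cases huE : u ∈ E
        · have h0 : X u = 0 := (hE u).1 huE
          by_cases huL : u ∈ L
          · simp only [Finset.mem_sdiff, huL, h0, not_true, and_false, if_false, if_true]
            linarith [h2 u huL]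
          · simp only [Finset.mem_sdiff, huE, huL, h0, not_false_iff, and_true, if_false, if_true]
            linarith [hpaired q u huE huL]
        · have huL : u ∉ L := fun h => huE (hLE h)
          have : X u ^ 2 = 16 := by
            rcases hcases u with (h | h) | h | h
            · rw [h]; norm_num
            · rw [h]; norm_num
            · exact absurd ((hO u).2 h) huO
            · exact absurd ((hE u).2 h) huE
          simp only [Finset.mem_sdiff, huE, huL, this, false_and, if_false]
          linarith [hwhole q u huO huE]
  by_cases hmixed : ∃ u ∈ L, ∃ o ∈ O, G.Adj u o
  · obtain ⟨u, huL, o, hoO, huo⟩ := hmixed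
    -- With `q = 1` an odd tuple pays at most 4 on each of three non-edges, and a member of `L` at
    -- most 12 on each of two, overdrawing by 8. As `L.card ≤ 2`, the total overdraft is at most the
    -- 16 saved by the mixed move.
    have hb := main 1 8 (by norm_num) (by norm_num) (fun w hw => ?_) (fun w hw => ?_)
    · have hu₁ : X₁ u = 0 := by
        rw [hX₁ u (by simp [huL])]
        exact (hE u).1 (hLE huL)
      have ho₁ : X₁ o = 2 ∨ X₁ o = -2 := by
        rw [hX₁ o (by simp [hOE o hoO])]
        exact (hO o).1 hoO
      obtain ⟨X₂, hb₂, hle₂⟩ := exists_mixed_move G X₁ hb₁ huo hu₁ ho₁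
      obtain ⟨s, hs, hle⟩ := exists_rounding G X₂ hb₂
      refine ⟨s, hs, ?_⟩
      have : (L.card : ℤ) ≤ 2 := by exact_mod_cast hLcard
      linarith
    · have hcard := card_le_three_of_injOn (hr w)
      have : ∑ v ∈ nonNeighbors G w, charge O E L r k 1 w v ≤ (nonNeighbors G w).card • (4 : ℤ) :=
        by
        refine Finset.sum_le_card_nsmul _ _ _ fun v _ => ?_
        simp only [charge, hw, if_true]
        split_ifs <;> norm_num
      rw [nsmul_eq_mul] at this
      have hcard' : ((nonNeighbors G w).card : ℤ) ≤ 3 := by exact_mod_cast hcard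
      linarith
    · have hwO := hLO w hw
      have hwE := hLE hw
      refine (sum_le_two_mul_of_injOn (hr w) (k w) (c := 12) (by norm_num) (fun v _ h => ?_)
        fun v _ => ?_).trans (by norm_num)
      · simp [charge, hwO, hwE, h]
      · simp only [charge, hwO, hwE, hw, if_true, if_false]
        split_ifs <;> norm_num
  · push Not at hmixed
    have hLOnon : ∀ u ∈ L, ∀ o ∈ O, o ∈ nonNeighbors G u := fun u hu o ho =>
      (mem_nonNeighbors G).2 ⟨fun h => hLO u hu (h ▸ ho), hmixed u hu o ho⟩
    -- Without a mixed move the odd tuples take over more: with `q = 3` a member of `L` pays at most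
    -- 8 on each of two non-edges, and no overdraft remains.
    have hb := main 3 0 (by norm_num) (by norm_num) (fun w hw => ?_) (fun w hw => ?_)
    · obtain ⟨s, hs, hle⟩ := exists_rounding G X₁ hb₁
      refine ⟨s, hs, ?_⟩
      linarith
    · by_cases hLe : L = ∅
      · have hcard := card_le_three_of_injOn (hr w)
        have : ∑ v ∈ nonNeighbors G w, charge O E L r k 3 w v ≤
            (nonNeighbors G w).card • (4 : ℤ) := by
          refine Finset.sum_le_card_nsmul _ _ _ fun v _ => ?_
          simp only [charge, hw, hLe, if_true, Finset.notMem_empty, if_false]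
          split_ifs <;> norm_num
        rw [nsmul_eq_mul] at this
        have hcard' : ((nonNeighbors G w).card : ℤ) ≤ 3 := by exact_mod_cast hcard
        linarith
      -- Here `u` is a non-neighbour of all other vertices of `O` and `L`. As the complement has no
      -- triangle, `w` has no further non-neighbour in `O` or `L` and spends its whole 12 on `u`.
      · obtain ⟨u, hu⟩ := Finset.nonempty_iff_ne_empty.2 hLe
        have hwu := hLOnon u hu w hw
        have huw := (mem_nonNeighbors_comm G).1 hwu
        rw [Finset.sum_eq_single_of_mem u huw]
        · simp [charge, hw, hu, hLO u hu]
        · intro v hv hvu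
          have hvO : v ∉ O := fun h => htri w u v huw hv ((mem_nonNeighbors_comm G).1 (hLOnon u hu
            v h))
          have hvL : v ∉ L := fun h => htri w u v huw hv (hnon v h u hu hvu)
          simp [charge, hw, hvO, hvL]
    · have hwO := hLO w hw
      have hwE := hLE hw
      refine (sum_le_two_mul_of_injOn (hr w) (k w) (c := 8) (by norm_num) (fun v _ h => ?_)
        fun v _ => ?_).trans (by norm_num)
      · simp [charge, hwO, hwE, h]
      · simp only [charge, hwO, hwE, hw, if_true, if_false]
        split_ifs <;> norm_num

end Discharging

/-! ### Edge counts as quadratic expressions in sign vectors. -/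

section Counting

variable {V : Type*} [Fintype V]

open Classical in
theorem two_mul_ncard_edgeSet (K : SimpleGraph V) :
    2 * (K.edgeSet.ncard : ℤ) = ∑ u, ∑ v, if K.Adj u v then 1 else 0 := by
  have h := K.sum_degrees_eq_twice_card_edges
  rw [← SimpleGraph.coe_edgeFinset, Set.ncard_coe_finset]
  have h' : (2 * (K.edgeFinset.card : ℤ)) = ((∑ v, K.degree v : ℕ) : ℤ) := by
    rw [h]; push_cast; ring
  rw [h', Nat.cast_sum]
  refine Finset.sum_congr rfl fun u _ => ?_
  rw [Finset.sum_boole, ← SimpleGraph.card_neighborFinset_eq_degree,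
    SimpleGraph.neighborFinset_eq_filter]

open Classical in
/-- The sign vector of a set. -/
noncomputable def setSign {V : Type*} (A : Set V) (u : V) : ℤ := if u ∈ A then 1 else -1

theorem setSign_eq {V : Type*} (A : Set V) (u : V) : setSign A u = 1 ∨ setSign A u = -1 := by
  unfold setSign
  split_ifs <;> simp

theorem mem_crossingPairs {V : Type*} (A : Set V) (u v : V) :
    s(u, v) ∈ crossingPairs A ↔ (u ∈ A ↔ v ∉ A) := by
  simp only [crossingPairs, Set.mem_ofPred_eq, Sym2.eq_iff]
  constructor
  · rintro ⟨x, hx, y, hy, ⟨rfl, rfl⟩ | ⟨rfl, rfl⟩⟩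
    · simp [hx, hy]
    · simp [hx, hy]
  · intro h
    by_cases hu : u ∈ A
    · exact ⟨u, hu, v, h.1 hu, Or.inl ⟨rfl, rfl⟩⟩
    · exact ⟨v, by_contra fun hv => hu (h.2 hv), u, hu, Or.inr ⟨rfl, rfl⟩⟩

open Classical in
theorem four_mul_ncard_cutset (K : SimpleGraph V) (A : Set V) :
    4 * ((cutset K A).ncard : ℤ) =
      ∑ u, ∑ v, if K.Adj u v then 1 - setSign A u * setSign A v else 0 := by
  -- A set of edges contains no loops, so it is the edge set of the graph it spans.
  have h : cutset K A = (SimpleGraph.fromEdgeSet (cutset K A)).edgeSet := by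
    rw [SimpleGraph.edgeSet_fromEdgeSet, eq_comm, sdiff_eq_left, Set.disjoint_left]
    exact fun e he => K.not_isDiag_of_mem_edgeSet he.1
  rw [h, show (4 : ℤ) = 2 * 2 by norm_num, mul_assoc, two_mul_ncard_edgeSet, Finset.mul_sum]
  refine Finset.sum_congr rfl fun u _ => ?_
  rw [Finset.mul_sum]
  refine Finset.sum_congr rfl fun v _ => ?_
  have : (SimpleGraph.fromEdgeSet (cutset K A)).Adj u v ↔ K.Adj u v ∧ (u ∈ A ↔ v ∉ A) := by
    rw [SimpleGraph.fromEdgeSet_adj, cutset, Set.mem_inter_iff, mem_crossingPairs,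
      SimpleGraph.mem_edgeSet]
    exact ⟨fun h => h.1, fun h => ⟨h, h.1.ne⟩⟩
  simp only [this, setSign]
  by_cases h1 : K.Adj u v <;> by_cases h2 : u ∈ A <;> by_cases h3 : v ∈ A <;> simp [h1, h2, h3]

open Classical in
theorem four_mul_ncard_sub_ncard_seidelSwitch (K : SimpleGraph V) (A : Set V) :
    4 * ((K.edgeSet.ncard : ℤ) - (seidelSwitch K A).edgeSet.ncard) =
      ∑ u, ∑ v, if u = v then 0 else
        (if K.Adj u v then 1 else -1) * (1 - setSign A u * setSign A v) := by
  rw [show (4 : ℤ) = 2 * 2 by norm_num, mul_assoc, mul_sub, two_mul_ncard_edgeSet,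
    two_mul_ncard_edgeSet, ← Finset.sum_sub_distrib, Finset.mul_sum]
  refine Finset.sum_congr rfl fun u _ => ?_
  rw [← Finset.sum_sub_distrib, Finset.mul_sum]
  refine Finset.sum_congr rfl fun v _ => ?_
  have : (seidelSwitch K A).Adj u v ↔ (Xor (K.Adj u v) (u ∈ A ↔ v ∉ A)) ∧ u ≠ v := by
    rw [seidelSwitch, SimpleGraph.fromEdgeSet_adj, Set.mem_symmDiff, mem_crossingPairs,
      SimpleGraph.mem_edgeSet]
    rfl
  simp only [this, setSign, Xor]
  by_cases h0 : u = v
  · subst h0; simp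
  · by_cases h1 : K.Adj u v <;> by_cases h2 : u ∈ A <;> by_cases h3 : v ∈ A <;>
      simp [h0, h1, h2, h3]

end Counting

/-! ### The blow-up graph and its encoding. -/

section BlowUp

theorem BlockKind.bit_nonedge_symm (a b : Fin 3) (i j : Fin 4) :
    (BlockKind.nonedge a b).bit i j = (BlockKind.nonedge b a).bit j i := by
  revert a b i j; decide

open BlowUpMachine (natAdj natAdj_val natAdj_symm natAdj_self)

/-- The graph that replaces every vertex by a four-tuple. -/
noncomputable def blowUp (G : FinGraph) : SimpleGraph (Fin G.1 × Fin 4) where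
  Adj p q := (blockKind (natAdj G) p.1 q.1).bit p.2 q.2 = true
  symm := ⟨by
    intro p q h
    unfold blockKind at h ⊢
    rw [natAdj_symm G q.1 p.1]
    split_ifs at h ⊢ with h1 h2 h3 h3
    · rfl
    · exact h
    · exact absurd h2.symm h3
    · exact absurd h3.symm h2
    · rwa [BlockKind.bit_nonedge_symm]⟩
  loopless := ⟨by
    intro p h
    simp [blockKind, natAdj_self, BlockKind.bit] at h⟩

/-- The rank of `v` among the vertices that are not adjacent to `u`, modulo `3`. -/
noncomputable def nonNeighborRank (G : FinGraph) (u v : Fin G.1) : Fin 3 :=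
  nonadjRank (natAdj G) u v

variable (G : FinGraph)

theorem blowUp_adj_of_adj {u v : Fin G.1} (h : G.2.Adj u v) (i j : Fin 4) :
    (blowUp G).Adj (u, i) (v, j) := by
  have h' := (natAdj_val G u v).2 h
  simp [blowUp, blockKind, h', BlockKind.bit]

theorem not_blowUp_adj_self (u : Fin G.1) (i j : Fin 4) : ¬ (blowUp G).Adj (u, i) (u, j) := by
  simp [blowUp, blockKind, natAdj_self, BlockKind.bit]

theorem blowUp_adj_of_not_adj {u v : Fin G.1} (hne : u ≠ v) (h : ¬ G.2.Adj u v) (i j : Fin 4) :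
    (blowUp G).Adj (u, i) (v, j) ↔
      (BlockKind.nonedge (nonNeighborRank G u v) (nonNeighborRank G v u)).bit i j = true := by
  have h' : ¬ natAdj G u v = true := fun h' => h ((natAdj_val G u v).1 h')
  have h'' : (u : ℕ) ≠ v := fun h => hne (Fin.ext h)
  simp [blowUp, blockKind, h', h'', nonNeighborRank]

/-- The graph that replaces every vertex by a four-tuple, on the vertices `0, …, 4n - 1`. -/
noncomputable def blowUpFin (G : FinGraph) : FinGraph :=
  ⟨G.1 * 4, (blowUp G).comap finProdFinEquiv.symm⟩

/-- The enumeration of the vertices of the blow-up. -/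
def blowUpEquiv (G : FinGraph) : Fin G.1 × Fin 4 ≃ Fin (blowUpFin G).1 := finProdFinEquiv

theorem blowUpFin_adj (p q : Fin G.1 × Fin 4) :
    (blowUpFin G).2.Adj (blowUpEquiv G p) (blowUpEquiv G q) ↔ (blowUp G).Adj p q := by
  change (blowUp G).Adj (finProdFinEquiv.symm (finProdFinEquiv p))
    (finProdFinEquiv.symm (finProdFinEquiv q)) ↔ _
  rw [Equiv.symm_apply_apply, Equiv.symm_apply_apply]

theorem isFourTupleGraph_blowUpFin : IsFourTupleGraph G.2 (blowUpFin G).2 := by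
  refine ⟨blowUpEquiv G, fun u i j => ?_, fun u v h i j => ?_, fun u v hne h => ?_⟩
  · rw [blowUpFin_adj]
    exact not_blowUp_adj_self G u i j
  · rw [blowUpFin_adj]
    exact blowUp_adj_of_adj G h i j
  -- The reflection `j ↦ 1 - j` turns the symmetric pattern `i + j ∈ {0, 1}` into `j ∈ {i, i + 1}`.
  · refine ⟨(splitPerm (nonNeighborRank G u v)).symm,
      (Equiv.subLeft 1).trans (splitPerm (nonNeighborRank G v u)).symm, fun i j => ?_⟩
    rw [blowUpFin_adj, blowUp_adj_of_not_adj G hne h]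
    simp only [BlockKind.bit, Equiv.trans_apply, Equiv.apply_symm_apply, Equiv.subLeft_apply]
    revert i j
    decide

theorem finRange_mul (n m : ℕ) :
    List.finRange (n * m) =
      (List.finRange n).flatMap fun u => (List.finRange m).map fun i => finProdFinEquiv (u, i) := by
  rw [← List.ofFn_id, List.ofFn_mul, List.ofFn_eq_map, List.flatMap]
  congr 1
  refine List.map_congr_left fun u _ => ?_
  rw [List.ofFn_eq_map]
  refine List.map_congr_left fun i _ => ?_
  ext
  simp [finProdFinEquiv]
  ring

open Classical in
-- The vertex `(u, i)` has index `4 * u + i`, so the rows of the new matrix come in groups of four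
-- in the order in which the machine emits them.
theorem encodeGraph_blowUpFin :
    encodeGraph (blowUpFin G) = BlowUpMachine.output (natAdj G) G.1 := by
  have hr : List.range G.1 = (List.finRange G.1).map Fin.val := by simp
  have hf : List.finRange (blowUpFin G).1 = (List.finRange G.1).flatMap fun u =>
      (List.finRange 4).map fun i => blowUpEquiv G (u, i) := finRange_mul G.1 4
  unfold encodeGraph BlowUpMachine.output
  rw [hf, hr, List.flatMap_map, ← List.flatMap_def, List.flatMap_assoc]
  refine List.flatMap_congr fun u _ => ?_
  rw [List.flatMap_map, BlowUpMachine.rowOutput]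
  refine List.flatMap_congr fun i _ => ?_
  rw [adjacencyRow, BlowUpMachine.rowWord, BlowUpMachine.rowBlocks, hr]
  congr 1
  rw [hf, List.map_flatMap, List.map_map, List.flatMap_map]
  refine List.flatMap_congr fun v _ => ?_
  have h4 : List.finRange 4 = [0, 1, 2, 3] := by decide
  have hadj : ∀ j, decide ((blowUpFin G).2.Adj (blowUpEquiv G (u, i)) (blowUpEquiv G (v, j))) =
      (blockKind (natAdj G) u v).bit i j := by
    intro j
    rw [Bool.eq_iff_iff, decide_eq_true_iff, blowUpFin_adj]
    rfl
  simp [h4, BlockKind.word]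
  exact ⟨hadj 0, hadj 1, hadj 2, hadj 3⟩

theorem polyTimeGraphMap_blowUpFin : PolyTimeGraphMap blowUpFin :=
  BlowUpMachine.polyTimeGraphMap_of_output encodeGraph_blowUpFin

end BlowUp

/-! ### Distinct ranks for the non-neighbours of a vertex. -/

section NonNeighborRank

theorem nonadjRank_eq_count (adj : ℕ → ℕ → Bool) (u v : ℕ) :
    nonadjRank adj u v = Fin.ofNat 3 (Nat.count (fun w => adj u w = false ∧ u ≠ w) v) := by
  induction v with
  | zero => simp [nonadjRank]
  | succ v ih =>
    rw [nonadjRank, Nat.count_succ, ih]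
    split_ifs with h
    · ext
      simp [Fin.val_add]
    · rfl

open BlowUpMachine (natAdj natAdj_val)

open Classical in
theorem injOn_nonNeighborRank (G : FinGraph) (u : Fin G.1) (h : (nonNeighbors G.2 u).card ≤ 3) :
    Set.InjOn (nonNeighborRank G u) (nonNeighbors G.2 u) := by
  set p : ℕ → Prop := fun w => natAdj G u w = false ∧ (u : ℕ) ≠ w with hp
  have hpN : ∀ w : Fin G.1, p w ↔ w ∈ nonNeighbors G.2 u := by
    intro w
    change natAdj G u w = false ∧ (u : ℕ) ≠ w ↔ _
    rw [mem_nonNeighbors, and_comm, ← natAdj_val, Bool.not_eq_true, ne_comm, Fin.val_ne_iff]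
  -- Among at most three non-neighbours, `w` has at most two before it; hence counting modulo 3
  -- loses nothing.
  have hcount : ∀ w ∈ nonNeighbors G.2 u, Nat.count p (w : ℕ) ≤ 2 := by
    intro w hw
    have hle : Nat.count p (w : ℕ) ≤ ((nonNeighbors G.2 u).erase w).card := by
      rw [Nat.count_eq_card_filter_range]
      refine Finset.card_le_card_of_surjOn Fin.val fun k hk => ?_
      simp only [Finset.coe_filter, Finset.mem_range, Set.mem_ofPred_eq] at hk
      refine ⟨⟨k, hk.1.trans w.2⟩, ?_, rfl⟩
      rw [Finset.mem_coe, Finset.mem_erase]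
      exact ⟨fun h => hk.1.ne (congrArg Fin.val h), (hpN _).1 hk.2⟩
    rw [Finset.card_erase_of_mem hw] at hle
    omega
  have hlt : ∀ v ∈ nonNeighbors G.2 u, ∀ w ∈ nonNeighbors G.2 u, v < w →
      nonNeighborRank G u v ≠ nonNeighborRank G u w := by
    intro v hv w hw hvw heq
    have h1 := Nat.count_strict_mono ((hpN v).2 hv) hvw
    have h2 := hcount w hw
    rw [nonNeighborRank, nonNeighborRank, nonadjRank_eq_count, nonadjRank_eq_count] at heq
    have h3 := congrArg Fin.val heq
    simp only [Fin.val_ofNat] at h3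
    change Nat.count p v % 3 = Nat.count p w % 3 at h3
    omega
  intro v hv w hw heq
  rcases lt_trichotomy v w with h' | h' | h'
  · exact absurd heq (hlt v hv w hw h')
  · exact h'
  · exact absurd heq.symm (hlt w hw v hv h')

end NonNeighborRank

/-! ### Gains of switches of the blow-up compared with cuts. -/

section BlockSums

open Classical in
theorem sum_blowUp_block (G : FinGraph) (x : Fin G.1 × Fin 4 → ℤ)
    (hx : ∀ p, x p = 1 ∨ x p = -1) (u v : Fin G.1) :
    (∑ i, ∑ j, if ((u, i) : Fin G.1 × Fin 4) = (v, j) then 0 else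
        (if (blowUp G).Adj (u, i) (v, j) then 1 else -1) * (1 - x (u, i) * x (v, j))) =
      ((if G.2.Adj u v then 16 - (∑ i, x (u, i)) * ∑ i, x (v, i) else 0) +
        if u = v then -(16 - (∑ i, x (u, i)) ^ 2) else 0) +
        if v ∈ nonNeighbors G.2 u then
          -blockForm (nonNeighborRank G u v) (nonNeighborRank G v u) (fun i => x (u, i))
            (fun i => x (v, i))
        else 0 := by
  by_cases huv : u = v
  · subst huv
    -- The omitted pairs `p = q` fit the same formula, since `x p * x p - 1 = 0`.
    have h : ∀ i j, (if ((u, i) : Fin G.1 × Fin 4) = (u, j) then 0 else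
        (if (blowUp G).Adj (u, i) (u, j) then 1 else -1) * (1 - x (u, i) * x (u, j))) =
          x (u, i) * x (u, j) - 1 := by
      intro i j
      rw [if_neg (not_blowUp_adj_self G u i j)]
      split_ifs with hij
      · rw [← hij]
        rcases hx (u, i) with h | h <;> rw [h] <;> norm_num
      · ring
    simp only [h, mem_nonNeighbors, G.2.irrefl, if_true, if_false, ne_eq, not_true, false_and,
      Fin.sum_univ_four]
    ring
  · have hne : ∀ i j, ¬ ((u, i) : Fin G.1 × Fin 4) = (v, j) := fun i j h =>
      huv (congrArg Prod.fst h)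
    by_cases hadj : G.2.Adj u v
    · simp only [hne, blowUp_adj_of_adj G hadj, huv, hadj, mem_nonNeighbors, if_true, if_false,
        not_true, and_false, Fin.sum_univ_four]
      ring
    · simp only [hne, blowUp_adj_of_not_adj G huv hadj, huv, Ne.symm huv, hadj, mem_nonNeighbors,
        if_true, if_false, ne_eq, not_false_iff, and_true, zero_add]
      have h0 := sum_blockSign (nonNeighborRank G u v) (nonNeighborRank G v u)
      have h : ∀ i j, (if (BlockKind.nonedge (nonNeighborRank G u v)
          (nonNeighborRank G v u)).bit i j = true then (1 : ℤ) else -1) =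
            blockSign (nonNeighborRank G u v) (nonNeighborRank G v u) i j := fun i j => rfl
      simp only [h, mul_sub, mul_one, Finset.sum_sub_distrib, h0, blockForm]
      simp

open Classical in
theorem sum_blowUp (G : FinGraph) (x : Fin G.1 × Fin 4 → ℤ) (hx : ∀ p, x p = 1 ∨ x p = -1) :
    (∑ p, ∑ q, if p = q then 0 else
        (if (blowUp G).Adj p q then 1 else -1) * (1 - x p * x q)) =
      (∑ u, ∑ v, if G.2.Adj u v then 16 else 0) -
        adjForm G.2 (fun u => ∑ i, x (u, i)) (fun u => ∑ i, x (u, i)) -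
        ∑ u, (16 - (∑ i, x (u, i)) ^ 2) -
        ∑ u, ∑ v ∈ nonNeighbors G.2 u, blockForm (nonNeighborRank G u v) (nonNeighborRank G v u)
          (fun i => x (u, i)) (fun i => x (v, i)) := by
  have h1 : (∑ p, ∑ q, if p = q then 0 else
        (if (blowUp G).Adj p q then 1 else -1) * (1 - x p * x q)) =
      ∑ u, ∑ v, ∑ i, ∑ j, if ((u, i) : Fin G.1 × Fin 4) = (v, j) then 0 else
        (if (blowUp G).Adj (u, i) (v, j) then 1 else -1) * (1 - x (u, i) * x (v, j)) := by
    simp only [Fintype.sum_prod_type]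
    exact Finset.sum_congr rfl fun u _ => Finset.sum_comm
  rw [h1]
  simp only [sum_blowUp_block G x hx, Finset.sum_add_distrib, Finset.sum_ite_eq,
    Finset.mem_univ, if_true, Finset.sum_ite_mem, Finset.univ_inter, Finset.sum_neg_distrib]
  have h2 : (∑ u, ∑ v, if G.2.Adj u v then 16 - (∑ i, x (u, i)) * ∑ i, x (v, i) else 0) =
      (∑ u, ∑ v, if G.2.Adj u v then 16 else 0) -
        adjForm G.2 (fun u => ∑ i, x (u, i)) (fun u => ∑ i, x (u, i)) := by
    rw [adjForm, ← Finset.sum_sub_distrib]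
    refine Finset.sum_congr rfl fun u _ => ?_
    rw [← Finset.sum_sub_distrib]
    refine Finset.sum_congr rfl fun v _ => ?_
    split_ifs <;> simp
  rw [h2]
  ring

open Classical in
/-- The gain of a switch of the blow-up, as a sum over the pairs of vertices of the blow-up. -/
theorem four_mul_gain_blowUpFin (G : FinGraph) (A : Set (Fin (blowUpFin G).1)) :
    4 * (((blowUpFin G).2.edgeSet.ncard : ℤ) - (seidelSwitch (blowUpFin G).2 A).edgeSet.ncard) =
      ∑ p, ∑ q, if p = q then 0 else (if (blowUp G).Adj p q then 1 else -1) *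
        (1 - setSign A (blowUpEquiv G p) * setSign A (blowUpEquiv G q)) := by
  rw [four_mul_ncard_sub_ncard_seidelSwitch, ← Equiv.sum_comp (blowUpEquiv G)]
  refine Finset.sum_congr rfl fun p _ => ?_
  rw [← Equiv.sum_comp (blowUpEquiv G)]
  refine Finset.sum_congr rfl fun q _ => ?_
  simp only [blowUpFin_adj, EmbeddingLike.apply_eq_iff_eq]

open Classical in
theorem four_mul_ncard_cutset_eq (G : FinGraph) (A : Set (Fin G.1)) :
    64 * ((cutset G.2 A).ncard : ℤ) = (∑ u, ∑ v, if G.2.Adj u v then 16 else 0) -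
      adjForm G.2 ((4 : ℤ) • setSign A) ((4 : ℤ) • setSign A) := by
  rw [show (64 : ℤ) = 16 * 4 by norm_num, mul_assoc, four_mul_ncard_cutset, adjForm,
    ← Finset.sum_sub_distrib, Finset.mul_sum]
  refine Finset.sum_congr rfl fun u _ => ?_
  rw [← Finset.sum_sub_distrib, Finset.mul_sum]
  refine Finset.sum_congr rfl fun v _ => ?_
  split_ifs
  · simp only [Pi.smul_apply, smul_eq_mul]
    ring
  · simp

/-- A switch by a union of four-tuples gains `16` edges for every cut-edge. -/
theorem exists_switch_of_cut (G : FinGraph) (V₁ : Set (Fin G.1)) :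
    ∃ A : Set (Fin (blowUpFin G).1),
      ((seidelSwitch (blowUpFin G).2 A).edgeSet.ncard : ℤ) =
        ((blowUpFin G).2.edgeSet.ncard : ℤ) - 16 * (cutset G.2 V₁).ncard := by
  classical
  refine ⟨{w | ((blowUpEquiv G).symm w).1 ∈ V₁}, ?_⟩
  set A : Set (Fin (blowUpFin G).1) := {w | ((blowUpEquiv G).symm w).1 ∈ V₁} with hA
  have hsign : ∀ p, setSign A (blowUpEquiv G p) = setSign V₁ p.1 := by
    intro p
    simp [setSign, hA]
  have h1 := four_mul_gain_blowUpFin G A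
  simp only [hsign] at h1
  have hx : ∀ p : Fin G.1 × Fin 4, setSign V₁ p.1 = 1 ∨ setSign V₁ p.1 = -1 :=
    fun p => setSign_eq V₁ p.1
  rw [sum_blowUp G (fun p => setSign V₁ p.1) hx] at h1
  have h2 := four_mul_ncard_cutset_eq G V₁
  have hsum : (fun u : Fin G.1 => ∑ _i : Fin 4, setSign V₁ u) = (4 : ℤ) • setSign V₁ := by
    funext u
    simp
  have hsq : ∀ u : Fin G.1, 16 - (∑ _i : Fin 4, setSign V₁ u) ^ 2 = 0 := by
    intro u
    rcases setSign_eq V₁ u with h | h <;> simp [h]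
  have hform : ∀ u v : Fin G.1, blockForm (nonNeighborRank G u v) (nonNeighborRank G v u)
      (fun _ => setSign V₁ u) (fun _ => setSign V₁ v) = 0 := by
    intro u v
    refine blockForm_eq_zero _ _ (fun _ => setSign_eq V₁ u) (fun _ => setSign_eq V₁ v) ?_
    rcases setSign_eq V₁ u with h | h <;> simp [h]
  simp only [hsum, hsq, hform, Finset.sum_const_zero] at h1
  linarith

open Classical in
theorem card_nonNeighbors_le (G : FinGraph) (hG : IsLargeDegGraph G.2) (u : Fin G.1) :
    (nonNeighbors G.2 u).card ≤ 3 := by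
  obtain ⟨n, hn, hmin, -⟩ := hG
  have h1 := G.2.minDegree_le_degree u
  have h2 : (nonNeighbors G.2 u) = (insert u (G.2.neighborFinset u))ᶜ := by
    ext v
    simp [mem_nonNeighbors]
  have h3 : u ∉ G.2.neighborFinset u := by simp
  -- The count is at most `2n - 1 - (2n - 4) = 3`.
  rw [h2, Finset.card_compl, Finset.card_insert_of_notMem h3,
    SimpleGraph.card_neighborFinset_eq_degree]
  omega

theorem nonNeighbors_triangleFree {V : Type*} [Fintype V] [DecidableEq V] (G : SimpleGraph V)
    [DecidableRel G.Adj] (hG : Gᶜ.CliqueFree 3) (u v w : V)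
    (hv : v ∈ nonNeighbors G u) (hw : w ∈ nonNeighbors G u) : v ∉ nonNeighbors G w := by
  intro hvw
  rw [mem_nonNeighbors] at hv hw hvw
  refine hG {u, v, w} (SimpleGraph.is3Clique_triple_iff.2 ⟨?_, ?_, ?_⟩)
  · exact (SimpleGraph.compl_adj _ _ _).2 ⟨hv.1.symm, hv.2⟩
  · exact (SimpleGraph.compl_adj _ _ _).2 ⟨hw.1.symm, hw.2⟩
  · exact (SimpleGraph.compl_adj _ _ _).2 ⟨hvw.1, fun h => hvw.2 h.symm⟩

/-- Every switch of the blow-up is matched by a cut. -/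
theorem exists_cut_of_switch (G : FinGraph) (hG : IsLargeDegGraph G.2)
    (A : Set (Fin (blowUpFin G).1)) :
    ∃ V₁ : Set (Fin G.1), ((blowUpFin G).2.edgeSet.ncard : ℤ) - 16 * (cutset G.2 V₁).ncard ≤
      (seidelSwitch (blowUpFin G).2 A).edgeSet.ncard := by
  classical
  have hr : ∀ u, Set.InjOn (nonNeighborRank G u) (nonNeighbors G.2 u) := fun u =>
    injOn_nonNeighborRank G u (card_nonNeighbors_le G hG u)
  obtain ⟨-, -, -, hfree⟩ := hG
  obtain ⟨s, hs, hle⟩ := exists_sign_adjForm_le G.2 (nonNeighborRank G)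
    (fun u i => setSign A (blowUpEquiv G (u, i))) (fun u i => setSign_eq A _) hr
    (nonNeighbors_triangleFree G.2 hfree)
  refine ⟨{u | s u = 1}, ?_⟩
  have hsign : setSign {u | s u = 1} = s := by
    funext u
    rcases hs u with h | h <;> simp [setSign, h]
  have h1 := four_mul_gain_blowUpFin G A
  rw [sum_blowUp G (fun p => setSign A (blowUpEquiv G p)) fun p => setSign_eq A _] at h1
  have h2 := four_mul_ncard_cutset_eq G {u | s u = 1}
  rw [hsign] at h2
  linarith

end BlockSums

theorem proposition4 :
    ∃ F : FinGraph → FinGraph, PolyTimeGraphMap F ∧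
      ∀ G : FinGraph,
        (F G).1 = 4 * G.1 ∧
        IsFourTupleGraph G.2 (F G).2 ∧
        (IsLargeDegGraph G.2 → ∀ j : ℤ,
          (∃ V₁ : Set (Fin G.1), j ≤ ((cutset G.2 V₁).ncard : ℤ)) ↔
            ∃ A : Set (Fin (F G).1),
              ((seidelSwitch (F G).2 A).edgeSet.ncard : ℤ) ≤
                ((F G).2.edgeSet.ncard : ℤ) - 16 * j) := by
  refine ⟨blowUpFin, polyTimeGraphMap_blowUpFin, fun G =>
    ⟨Nat.mul_comm _ _, isFourTupleGraph_blowUpFin G, fun hG j => ⟨?_, ?_⟩⟩⟩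
  · rintro ⟨V₁, hV₁⟩
    obtain ⟨A, hA⟩ := exists_switch_of_cut G V₁
    exact ⟨A, by linarith⟩
  · rintro ⟨A, hA⟩
    obtain ⟨V₁, hV₁⟩ := exists_cut_of_switch G hG A
    exact ⟨V₁, by linarith⟩
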